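/- Let $q\ge 2$ and let $\mathbb T$ be the $(q+1)$-regular tree with a distinguished vertex $o$ and a distinguished end $\omega$. Its vertices are labelled as follows: the vertices of the horocycle $H_m$ ($m\in\mathbb Z$) are the sequences $(u_k)_{k\le m}$ with values in $\{0,\dots,q-1\}$ that vanish near $-\infty$; each vertex is joined to its first ancestor, obtained by deleting its last letter; $o\in H_0$ is the zero sequence and $\omega$ is the end of the ray of ancestors of $o$. Let $\mathrm{Aff}(\mathbb T)$ be the group of automorphisms of $\mathbb T$ that fix $\omega$, acting on the right, and let $\Phi:\mathrm{Aff}(\mathbb T)\to\mathbb Z$ be the homomorphism such that $v.g\in H_{m+\Phi(g)}$ for $v\in H_m$. The portrait of $g\in\mathrm{Aff}(\mathbb T)$ is the function $v\mapsto g[v]\in\mathfrak S_q$ determined by $(vt).g=(v.g)(t.g[v])$ for each vertex $v$ and letter $t$, where $vt$ is $v$ with the letter $t$ appended. The discrete affine group $\mathrm{DA}(\mathbb T)$ consists of the $g\in\mathrm{Aff}(\mathbb T)$ with $g[v]=e$ for all but finitely many $v$. Call a probability measure $\mu$ on $\mathrm{DA}(\mathbb T)$ aperiodic if for any $g,g'\in\mathrm{DA}(\mathbb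 T)$ there is $l\ge1$ such that the support of the $l$-fold convolution power of $\mu$ contains both $g$ and $g'$. Write $\check\mu(g)=\mu(g^{-1})$. Let $w_n=x_1\cdots x_n$, $w_0=e$, be the right random walk with independent increments $x_i$ of law $\mu$. When, almost surely, $w_n[v]$ is eventually constant for every vertex $v$, with limit $\gamma_\infty[v]$, the harmonic measure of $\mu$ is the law of $\gamma_\infty$ on $\prod_{\mathbb T}\mathfrak S_q$. **Proposition.** Let $\mu_-,\mu_0,\mu_+$ be finitely supported aperiodic probability measures on $\mathrm{DA}(\mathbb T)$ with $$\mathbb E_{\check\mu_-}\Phi<0,\qquad \mathbb E_{\check\mu_0}\Phi=0,\qquad \mathbb E_{\check\mu_+}\Phi>0 .$$ Then for each of the three the portraits of the walk stabilize almost surely at every vertex, so that the harmonic measures $\nu_-,\nu_0,\nu_+$ are defined, and these have distinct supports in the measure-theoretic sense: there are pairwise disjoint Borel sets $A_-,A_0,A_+\subset\prod_{\mathbb T}\mathfrak S_q$ with $\nu_-(A_-)=\nu_0(A_0)=\nu_+(A_+)=1$. In particular, $\nu_-,\nu_0,\nu_+$ are pairwise mutually singular. -/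

import Mathlib

open MeasureTheory Filter Set

/-- A vertex of the `(q+1)`-regular tree, in its standard labelling relative to the chosen end:
an integer `level` (the index of its horocycle) and a sequence of letters in `{0, …, q-1}` indexed
by the integers `k ≤ level`, equal to `0` near `-∞`.  The entries at indices `k > level` do not
belong to the label; they are set to `0`, so that each vertex has exactly one encoding. -/
@[ext]
structure TreeVertex (q : ℕ) [NeZero q] where
  level : ℤ
  digit : ℤ → Fin q
  digit_above : ∀ k, level < k → digit k = 0
  digit_below : ∃ n, ∀ k, k ≤ n → digit k = 0

namespace TreeVertex

variable {q : ℕ} [NeZero q]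

/-- The first ancestor: delete the last letter. -/
def parent (v : TreeVertex q) : TreeVertex q where
  level := v.level - 1
  digit := Function.update v.digit v.level 0
  digit_above := by
    intro k hk
    by_cases h : k = v.level
    · simp [h]
    · rw [Function.update_of_ne h]
      exact v.digit_above k (by omega)
  digit_below := by
    obtain ⟨n, hn⟩ := v.digit_below
    refine ⟨n, fun k hk => ?_⟩
    by_cases h : k = v.level
    · simp [h]
    · rw [Function.update_of_ne h]
      exact hn k hk

/-- The descendant `vt`: append the letter `t`. -/
def child (v : TreeVertex q) (t : Fin q) : TreeVertex q where
  level := v.level + 1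
  digit := Function.update v.digit (v.level + 1) t
  digit_above := by
    intro k hk
    rw [Function.update_of_ne (by omega)]
    exact v.digit_above k (by omega)
  digit_below := by
    obtain ⟨n, hn⟩ := v.digit_below
    refine ⟨min n v.level, fun k hk => ?_⟩
    rw [Function.update_of_ne (by omega)]
    exact hn k (by omega)

/-- The last (rightmost) letter of the label. -/
def last (v : TreeVertex q) : Fin q := v.digit v.level

/-- The vertex `ω(n)` of the geodesic ray from `o = ω(0)` to the distinguished end `ω`: the
sequence constant equal to `0` on `]-∞, -n]`. -/
def ray (q : ℕ) [NeZero q] (n : ℕ) : TreeVertex q where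
  level := -(n : ℤ)
  digit := fun _ => 0
  digit_above := fun _ _ => rfl
  digit_below := ⟨0, fun _ _ => rfl⟩

/-- The base vertex `o`. -/
def root (q : ℕ) [NeZero q] : TreeVertex q := ray q 0

/-- The `(q+1)`-regular tree: edges link each vertex to its first ancestor. -/
def graph (q : ℕ) [NeZero q] : SimpleGraph (TreeVertex q) where
  Adj v w := v = parent w ∨ w = parent v
  symm := ⟨fun _ _ h => Or.symm h⟩
  loopless := ⟨fun v h => by
    have : v.level = v.level - 1 := by
      rcases h with h | h <;> exact congrArg level h
    omega⟩

@[simp] theorem parent_child (v : TreeVertex q) (t : Fin q) : (v.child t).parent = v := by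
  ext k
  · simp [parent, child]
  · by_cases h : k = v.level + 1
    · subst h
      simp [parent, child, v.digit_above (v.level + 1) (by omega)]
    · simp [parent, child, h]

@[simp] theorem last_child (v : TreeVertex q) (t : Fin q) : (v.child t).last = t := by
  simp [last, child]

theorem child_last (v : TreeVertex q) : v.parent.child v.last = v := by
  ext k
  · simp [parent, child]
  · by_cases h : k = v.level
    · subst h
      simp [parent, child, last]
    · simp [parent, child, h]

theorem level_iterate_parent (v : TreeVertex q) (k : ℕ) :
    (parent^[k] v).level = v.level - k := by
  induction k with
  | zero => simp
  | succ k ih =>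
    rw [Function.iterate_succ_apply']
    simp only [parent, ih]
    push_cast
    ring

theorem digit_iterate_parent (v : TreeVertex q) (k : ℕ) (j : ℤ) :
    (parent^[k] v).digit j = if j ≤ v.level - k then v.digit j else 0 := by
  induction k with
  | zero =>
    by_cases h : j ≤ v.level
    · simp [h]
    · simp [h, v.digit_above j (by omega)]
  | succ k ih =>
    rw [Function.iterate_succ_apply']
    simp only [parent, level_iterate_parent]
    by_cases h : j = v.level - k
    · subst h
      rw [Function.update_self, if_neg (by push_cast; omega)]
    · rw [Function.update_of_ne h, ih]
      push_cast
      by_cases h' : j ≤ v.level - k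
      · rw [if_pos h', if_pos (by omega)]
      · rw [if_neg h', if_neg (by omega)]

/-- From every vertex, the ascending ray eventually follows the ray `ω`. -/
theorem exists_iterate_parent_mem_ray (v : TreeVertex q) :
    ∃ N : ℕ, ∀ k, N ≤ k → parent^[k] v ∈ range (ray q) := by
  obtain ⟨n, hn⟩ := v.digit_below
  refine ⟨(v.level - n).toNat + v.level.toNat, fun k hk => ?_⟩
  refine ⟨(k - v.level).toNat, ?_⟩
  ext j
  · rw [level_iterate_parent]
    simp only [ray]
    omega
  · rw [digit_iterate_parent]
    simp only [ray]
    by_cases h : j ≤ v.level - k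
    · rw [if_pos h, hn j (by omega)]
    · rw [if_neg h]

end TreeVertex

open TreeVertex

/-- The affine group of the tree: the graph automorphisms that fix the end `ω`, that is, map the
ray `ω` to an equivalent ray (two rays are equivalent when their symmetric difference is finite).
Automorphisms act on the right: `v.g` is `g.unop v`, and in the product `g * h` the factor `g` is
applied first; hence the opposite of Mathlib's group of automorphisms. -/
def AffTree (q : ℕ) [NeZero q] : Subgroup (graph q ≃g graph q)ᵐᵒᵖ where
  carrier := {g | (symmDiff (range (ray q)) (g.unop '' range (ray q))).Finite}
  one_mem' := by
    have : ((1 : (graph q ≃g graph q)ᵐᵒᵖ).unop '' range (ray q)) = range (ray q) :=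
      image_id _
    simp only [mem_ofPred_eq, this, symmDiff_self]
    exact finite_empty
  mul_mem' := by
    intro g h hg hh
    have e : (g * h).unop '' range (ray q) = h.unop '' (g.unop '' range (ray q)) := by
      rw [← image_comp]
      rfl
    have h1 : (symmDiff (h.unop '' range (ray q)) (h.unop '' (g.unop '' range (ray q)))).Finite := by
      rw [← image_symmDiff h.unop.injective]
      exact hg.image _
    simp only [mem_ofPred_eq, e] at hg hh ⊢
    exact (hh.union h1).subset (symmDiff_triangle _ _ _)
  inv_mem' := by
    intro g hg
    have e : g.unop '' (g⁻¹.unop '' range (ray q)) = range (ray q) := by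
      rw [← image_comp]
      have : (g.unop ∘ g⁻¹.unop : TreeVertex q → TreeVertex q) = id := by
        funext x
        exact RelIso.apply_inv_self g.unop x
      rw [this, image_id]
    simp only [mem_ofPred_eq] at hg ⊢
    have h1 : (g.unop '' symmDiff (range (ray q)) (g⁻¹.unop '' range (ray q))).Finite := by
      rw [image_symmDiff g.unop.injective, e, symmDiff_comm]
      exact hg
    exact h1.of_finite_image g.unop.injective.injOn

namespace AffTree

variable {q : ℕ} [NeZero q]

/-- The right action `v.g` of the affine group on the vertices. -/
def act (v : TreeVertex q) (g : AffTree q) : TreeVertex q := g.1.unop v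

theorem act_mul (v : TreeVertex q) (g h : AffTree q) : act v (g * h) = act (act v g) h := rfl

theorem act_one (v : TreeVertex q) : act v (1 : AffTree q) = v := rfl

theorem act_inv_act (v : TreeVertex q) (g : AffTree q) : act (act v g) g⁻¹ = v := by
  rw [← act_mul, mul_inv_cancel, act_one]

theorem act_act_inv (v : TreeVertex q) (g : AffTree q) : act (act v g⁻¹) g = v := by
  rw [← act_mul, inv_mul_cancel, act_one]

theorem act_injective (g : AffTree q) : Function.Injective fun v => act v g :=
  g.1.unop.injective

/-- Elements of the affine group map first ancestors to first ancestors. -/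
theorem act_parent (v : TreeVertex q) (g : AffTree q) : act v.parent g = (act v g).parent := by
  have adj : ∀ k : ℕ, act (parent^[k] v) g = (act (parent^[k + 1] v) g).parent ∨
      act (parent^[k + 1] v) g = (act (parent^[k] v) g).parent := by
    intro k
    have h : (graph q).Adj (parent^[k] v) (parent^[k + 1] v) := by
      rw [Function.iterate_succ_apply']
      exact Or.inr rfl
    exact g.1.unop.map_adj_iff.mpr h
  by_contra hne
  have down : ∀ k : ℕ, act (parent^[k] v) g = (act (parent^[k + 1] v) g).parent := by
    intro k
    induction k with
    | zero =>
      rcases adj 0 with h | h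
      · exact h
      · exact absurd h hne
    | succ k ih =>
      rcases adj (k + 1) with h | h
      · exact h
      · exfalso
        have h2 := act_injective g (h.trans ih.symm)
        have h3 := congrArg level h2
        rw [level_iterate_parent, level_iterate_parent] at h3
        push_cast at h3
        omega
  have lev : ∀ k : ℕ, (act (parent^[k] v) g).level = (act v g).level + k := by
    intro k
    induction k with
    | zero => simp
    | succ k ih =>
      have h := congrArg level (down k)
      rw [ih] at h
      simp only [parent] at h
      push_cast
      omega
  obtain ⟨N, hN⟩ := exists_iterate_parent_mem_ray v
  have hfin : (symmDiff (range (ray q)) (g.1.unop '' range (ray q))).Finite := g.2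
  have hinf : (range fun k : ℕ =>
      act (parent^[k + N + (act v g).level.natAbs + 1] v) g).Infinite := by
    refine infinite_range_of_injective fun a b hab => ?_
    have h := congrArg level hab
    simp only [lev] at h
    push_cast at h
    omega
  refine hinf (hfin.subset ?_)
  rintro _ ⟨k, rfl⟩
  refine Or.inr ⟨⟨_, hN _ (by omega), rfl⟩, ?_⟩
  rintro ⟨m, hm⟩
  have h := congrArg level hm
  simp only [lev] at h
  simp only [ray] at h
  omega

theorem act_child (v : TreeVertex q) (t : Fin q) (g : AffTree q) :
    act (v.child t) g = (act v g).child (act (v.child t) g).last := by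
  conv_lhs => rw [← child_last (act (v.child t) g), ← act_parent, parent_child]

/-- The portrait `g[v]` of `g`: the permutation of the letters determined by the automata rule
`(vt).g = (v.g)(t.g[v])`. -/
def portrait (g : AffTree q) (v : TreeVertex q) : Equiv.Perm (Fin q) where
  toFun t := (act (v.child t) g).last
  invFun t := (act ((act v g).child t) g⁻¹).last
  left_inv t := by
    change (act ((act v g).child (act (v.child t) g).last) g⁻¹).last = t
    rw [← act_child, act_inv_act, last_child]
  right_inv t := by
    have h := act_child (act v g) t g⁻¹
    rw [act_inv_act] at h
    change (act (v.child (act ((act v g).child t) g⁻¹).last) g).last = t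
    rw [← h, act_act_inv, last_child]

/-- The automata rule. -/
theorem automata_rule (g : AffTree q) (v : TreeVertex q) (t : Fin q) :
    act (v.child t) g = (act v g).child (portrait g v t) := act_child v t g

/-- The composition rule `(gh)[v] = g[v] h[v.g]`; permutations of letters also act on the right
in that formula, so that the factors appear in the other order here. -/
theorem portrait_mul (g h : AffTree q) (v : TreeVertex q) :
    portrait (g * h) v = portrait h (act v g) * portrait g v := by
  ext t
  have e : act (v.child t) (g * h) = (act v (g * h)).child
      (portrait h (act v g) (portrait g v t)) := by
    rw [act_mul, automata_rule, automata_rule, ← act_mul]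
  change ((act (v.child t) (g * h)).last : ℕ) = _
  rw [e, last_child]
  rfl

theorem portrait_one (v : TreeVertex q) : portrait (1 : AffTree q) v = 1 := by
  ext t
  change ((act (v.child t) 1).last : ℕ) = _
  rw [act_one, last_child]
  rfl

/-- The vertical displacement `Φ(g) = β(o.g) - β(o)`.  The Busemann function `β` of the end `ω`,
normalized by `β(o) = 0`, is the level: see `busemann_eq_level` below. -/
def vertical (g : AffTree q) : ℤ := (act (root q) g).level - (root q).level

end AffTree

/-- The level is the Busemann function `β(v) = lim (d(v, ω(n)) - d(o, ω(n)))` (the sequence is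
eventually constant). -/
theorem busemann_eq_level {q : ℕ} [NeZero q] (v : TreeVertex q) :
    ∀ᶠ n : ℕ in atTop, (((graph q).dist v (ray q n) : ℤ) - (graph q).dist (root q) (ray q n))
      = v.level := by
  have lower : ∀ {a b : TreeVertex q} (p : (graph q).Walk a b), a.level - b.level ≤ p.length := by
    intro a b p
    induction p with
    | nil => simp
    | cons h p ih =>
      rw [SimpleGraph.Walk.length_cons]
      push_cast
      rcases h with h | h
      · have := congrArg level h
        simp only [parent] at this
        omega
      · have := congrArg level h
        simp only [parent] at this
        omega
  have upper : ∀ (k : ℕ) (a : TreeVertex q),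
      ∃ p : (graph q).Walk a (parent^[k] a), p.length = k := by
    intro k
    induction k with
    | zero => exact fun a => ⟨SimpleGraph.Walk.nil, rfl⟩
    | succ k ih =>
      intro a
      obtain ⟨p, hp⟩ := ih a.parent
      have hadj : (graph q).Adj a a.parent := Or.inr rfl
      rw [Function.iterate_succ_apply]
      exact ⟨SimpleGraph.Walk.cons hadj p, by rw [SimpleGraph.Walk.length_cons, hp]⟩
  have key : ∀ (k : ℕ) (a : TreeVertex q), (graph q).dist a (parent^[k] a) = k := by
    intro k a
    obtain ⟨p, hp⟩ := upper k a
    refine le_antisymm ((SimpleGraph.dist_le p).trans hp.le) ?_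
    obtain ⟨p', hp'⟩ := (SimpleGraph.Walk.reachable p).exists_walk_length_eq_dist
    have := lower p'
    rw [level_iterate_parent, hp'] at this
    omega
  have main : ∀ a : TreeVertex q, ∀ᶠ n : ℕ in atTop,
      ((graph q).dist a (ray q n) : ℤ) = a.level + n := by
    intro a
    obtain ⟨N, hN⟩ := exists_iterate_parent_mem_ray a
    filter_upwards [eventually_ge_atTop (N + a.level.natAbs)] with n hn
    obtain ⟨m, hm⟩ := hN (a.level + n).toNat (by omega)
    have hl := congrArg level hm
    rw [level_iterate_parent] at hl
    simp only [ray] at hl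
    have hmn : m = n := by omega
    subst hmn
    rw [hm, key]
    omega
  filter_upwards [main v, main (root q)] with n h1 h2
  rw [h1, h2]
  simp [root, ray]

/-- The discrete affine group: the elements of the affine group whose portrait is trivial at all
but finitely many vertices. -/
def DATree (q : ℕ) [NeZero q] : Subgroup (AffTree q) where
  carrier := {g | {v | AffTree.portrait g v ≠ 1}.Finite}
  one_mem' := by simp [AffTree.portrait_one]
  mul_mem' := by
    intro g h hg hh
    refine (hg.union (hh.preimage (AffTree.act_injective g).injOn)).subset ?_
    intro v hv
    by_contra hc
    simp only [mem_union, mem_ofPred_eq, mem_preimage, not_or, not_not] at hc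
    exact hv (by rw [AffTree.portrait_mul, hc.1, hc.2, one_mul])
  inv_mem' := by
    intro g hg
    refine (hg.preimage (AffTree.act_injective g⁻¹).injOn).subset ?_
    intro v hv hc
    have h := AffTree.portrait_mul g⁻¹ g v
    rw [inv_mul_cancel, AffTree.portrait_one, hc, one_mul] at h
    exact hv h.symm

/-- The space of configurations, functions from the vertices of the tree to the symmetric group;
it carries the product `σ`-algebra of the discrete ones, which is its Borel `σ`-algebra for the
product topology because the tree is countable. -/
abbrev TreeConfig (q : ℕ) [NeZero q] : Type := TreeVertex q → Equiv.Perm (Fin q)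

instance instMeasurableSpacePermFin (q : ℕ) : MeasurableSpace (Equiv.Perm (Fin q)) := ⊤

instance instMeasurableSpaceDATree (q : ℕ) [NeZero q] : MeasurableSpace (DATree q) := ⊤

namespace DATree

variable {q : ℕ} [NeZero q]

/-- The `l`-fold convolution power of `μ`: the law of the product of `l` independent elements of
law `μ`. -/
noncomputable def convPow (μ : PMF (DATree q)) : ℕ → PMF (DATree q)
  | 0 => PMF.pure 1
  | l + 1 => (convPow μ l).bind fun g => μ.map fun h => g * h

/-- `μ` is aperiodic: any two group elements lie together in the support of some convolution
power of `μ`. -/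
def Aperiodic (μ : PMF (DATree q)) : Prop :=
  ∀ g h : DATree q, ∃ l : ℕ, 1 ≤ l ∧ g ∈ (convPow μ l).support ∧ h ∈ (convPow μ l).support

/-- The reversed measure `g ↦ μ(g⁻¹)`. -/
noncomputable def reverse (μ : PMF (DATree q)) : PMF (DATree q) := μ.map fun g => g⁻¹

/-- The mean vertical drift, the expectation of `Φ` under `μ` (used for finitely supported `μ`,
where the sum is finite). -/
noncomputable def drift (μ : PMF (DATree q)) : ℝ :=
  ∑' g : DATree q, (μ g).toReal * (AffTree.vertical (g : AffTree q) : ℝ)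

/-- The right random walk `wₙ = x₁ ⋯ xₙ` with increments `x 0, x 1, …`, started at `e`. -/
def walk (x : ℕ → DATree q) : ℕ → DATree q
  | 0 => 1
  | n + 1 => walk x n * x n

/-- The law of the sequence of independent increments of law `μ`. -/
noncomputable def incrementLaw (μ : PMF (DATree q)) : Measure (ℕ → DATree q) :=
  Measure.infinitePi fun _ : ℕ => μ.toMeasure

/-- The portraits of the walk stabilize at the vertex `v`, with final value `σ`. -/
def StabilizesTo (x : ℕ → DATree q) (v : TreeVertex q) (σ : Equiv.Perm (Fin q)) : Prop :=
  ∀ᶠ n : ℕ in atTop, AffTree.portrait (walk x n : AffTree q) v = σ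

open Classical in
/-- The final configuration, the pointwise limit of the portraits of the walk (the value at a
vertex where there is no limit is irrelevant, and set to `1`). -/
noncomputable def finalConfig (x : ℕ → DATree q) : TreeConfig q := fun v =>
  if h : ∃ σ, StabilizesTo x v σ then h.choose else 1

/-- The harmonic measure: the law of the final configuration. -/
noncomputable def harmonicMeasure (μ : PMF (DATree q)) : Measure (TreeConfig q) :=
  (incrementLaw μ).map finalConfig

end DATree

/-! ### Countability of the tree, induction from the ray, automorphisms -/

namespace TreeVertex

variable {q : ℕ} [NeZero q]

/-! By the composition rule, the portrait of the walk at `v` changes at time `n` only if the current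
position `v.w_n` carries a nontrivial portrait of the increment, hence lies in the finite set
`portraitSupport μ`. Moreover `v.w_n` has level `level v + Φ(w_n)`. So stabilization is a question
of transience of the chain `v.w_n` on the tree, and the place of the nontrivial final values is
governed by the one-dimensional walk `Φ(w_n)`.

Transience (`tsum_moves_lt_top`) holds whatever the drift. An element that moves `u` to one of its
children moves the first ancestor of `u` to `u`, so the expected times spent at two distinct
children of `u`, starting from `u`, add up to at most the time spent at `u` starting from its
ancestor, which is at most the time at `u` starting from `u`. Aperiodicity puts positive mass, at
one common time, on elements bringing either child to `u`. The resulting loss in the maximum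
principle bounds the Green function.

The drift of the reversed measure is the opposite of that of `μ`. When `Φ(w_n)` tends to `+∞`,
vertices at high levels never meet `portraitSupport μ`, and their final values are trivial; when it
tends to `-∞`, the same holds at low levels (`ae_finalConfig_notMem_unboundedConfigs`). Conversely,
if the walk brings vertices of arbitrarily high (or low) levels to the root, nontrivial final values
occur at such levels almost surely (`ae_finalConfig_mem_unboundedConfigs`): the final value at the
root differs from any given permutation with probability at least some `ε > 0`, a Markov argument
transports this bound to distant levels, and a zero-one law raises it to one. In the centred case
`Φ(w_n)` is unbounded on both sides, by martingale convergence.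

Thus the three harmonic measures are separated by whether the configuration is nontrivial at
arbitrarily high levels and at arbitrarily low levels: not the former, both, only the former. -/

instance : Countable (TreeVertex q) := by
  have hf : ∀ v : TreeVertex q, (Function.support fun k => (v.digit k : ℕ)).Finite := by
    intro v
    obtain ⟨n, hn⟩ := v.digit_below
    refine (Set.finite_Icc n v.level).subset fun k hk => ?_
    by_contra h
    rw [mem_Icc, not_and_or, not_le, not_le] at h
    rcases h with h | h
    · exact hk (by simp [hn k h.le])
    · exact hk (by simp [v.digit_above k h])
  refine Function.Injective.countable
    (f := fun v : TreeVertex q => (v.level, Finsupp.ofSupportFinite _ (hf v))) fun v w h => ?_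
  rw [Prod.mk.injEq] at h
  refine TreeVertex.ext h.1 (funext fun k => Fin.ext ?_)
  exact DFunLike.congr_fun h.2 k

theorem iterate_parent_ray (n k : ℕ) : parent^[k] (ray q n) = ray q (n + k) := by
  ext j
  · rw [level_iterate_parent]
    simp only [ray]
    push_cast
    ring
  · rw [digit_iterate_parent]
    split_ifs <;> rfl

/-- The descendants of the ray exhaust the tree. -/
theorem child_induction {motive : TreeVertex q → Prop} (hray : ∀ n, motive (ray q n))
    (hchild : ∀ v t, motive v → motive (v.child t)) (v : TreeVertex q) : motive v := by
  have key : ∀ (k : ℕ) (v : TreeVertex q), motive (parent^[k] v) → motive v := by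
    intro k
    induction k with
    | zero => exact fun v h => h
    | succ k ih =>
      intro v h
      rw [Function.iterate_succ_apply] at h
      rw [← child_last v]
      exact hchild _ _ (ih _ h)
  obtain ⟨N, hN⟩ := exists_iterate_parent_mem_ray v
  obtain ⟨m, hm⟩ := hN N le_rfl
  exact key N v (hm ▸ hray m)

/-- A permutation of the vertices that respects first ancestors is a graph automorphism. -/
def isoOfParent (e : TreeVertex q ≃ TreeVertex q) (he : ∀ v, e v.parent = (e v).parent) :
    graph q ≃g graph q where
  toEquiv := e
  map_rel_iff' := by
    intro v w
    change (e v = (e w).parent ∨ e w = (e v).parent) ↔ (v = w.parent ∨ w = v.parent)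
    rw [← he, ← he, e.injective.eq_iff, e.injective.eq_iff]

end TreeVertex

/-! ### Levels under the action; elements determined by portraits -/

namespace AffTree

variable {q : ℕ} [NeZero q]

theorem act_ray (g : AffTree q) (n : ℕ) : act (ray q n) g = parent^[n] (act (root q) g) := by
  induction n with
  | zero => rfl
  | succ n ih =>
    rw [Function.iterate_succ_apply', ← ih, ← act_parent, ← iterate_parent_ray n 1]
    rfl

/-- The displacement is constant along the ray because ancestors go to ancestors, and appending a
letter raises both levels by one. -/
theorem level_act (v : TreeVertex q) (g : AffTree q) :
    (act v g).level = v.level + vertical g := by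
  induction v using child_induction with
  | hray n =>
    rw [act_ray, level_iterate_parent]
    simp only [vertical, root, ray]
    push_cast
    ring
  | hchild v t ih =>
    rw [automata_rule]
    simp only [child, ih]
    ring

theorem vertical_mul (g h : AffTree q) : vertical (g * h) = vertical g + vertical h := by
  have h1 := level_act (root q) (g * h)
  rw [act_mul, level_act, level_act] at h1
  omega

theorem vertical_one : vertical (1 : AffTree q) = 0 := by
  simp [vertical, act_one]

theorem vertical_inv (g : AffTree q) : vertical g⁻¹ = -vertical g := by
  have h := vertical_mul g g⁻¹
  rw [mul_inv_cancel, vertical_one] at h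
  omega

theorem ext_act {g h : AffTree q} (e : ∀ v, act v g = act v h) : g = h := by
  apply Subtype.ext
  apply MulOpposite.unop_injective
  exact RelIso.ext e

/-- An element of the affine group is determined by the image of the root and the portrait. -/
theorem ext_portrait {g h : AffTree q} (h0 : act (root q) g = act (root q) h)
    (e : ∀ v, portrait g v = portrait h v) : g = h := by
  refine ext_act fun v => ?_
  induction v using child_induction with
  | hray n => rw [act_ray, act_ray, h0]
  | hchild v t ih => rw [automata_rule, automata_rule, ih, e]

/-- The element of the affine group given by a permutation of the vertices that respects first
ancestors and eventually shiftBys the ray of the distinguished end. -/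
def ofEquiv (e : TreeVertex q ≃ TreeVertex q) (he : ∀ v, e v.parent = (e v).parent) (a b : ℕ)
    (hray : ∀ n, e (ray q (n + a)) = ray q (n + b)) : AffTree q :=
  ⟨MulOpposite.op (isoOfParent e he), by
    change (symmDiff (range (ray q)) (e '' range (ray q))).Finite
    -- For `n ≥ b` the vertex `ray q n` is the image of `ray q (n - b + a)`, and for `n ≥ a` the
    -- image of `ray q n` is on the ray; only the initial segments can contribute.
    refine (((Set.finite_Iio b).image (ray q)).union
      ((Set.finite_Iio a).image (e ∘ ray q))).subset ?_
    rintro v (⟨⟨n, rfl⟩, hv⟩ | ⟨⟨_, ⟨n, rfl⟩, rfl⟩, hv⟩)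
    · refine Or.inl ⟨n, ?_, rfl⟩
      by_contra hn
      rw [mem_Iio, not_lt] at hn
      exact hv ⟨_, ⟨_, rfl⟩, (hray (n - b)).trans (by rw [Nat.sub_add_cancel hn])⟩
    · refine Or.inr ⟨n, ?_, rfl⟩
      by_contra hn
      rw [mem_Iio, not_lt] at hn
      refine hv ⟨n - a + b, ?_⟩
      rw [← hray, Nat.sub_add_cancel hn]⟩

theorem act_ofEquiv (e : TreeVertex q ≃ TreeVertex q) (he : ∀ v, e v.parent = (e v).parent)
    (a b : ℕ) (hray : ∀ n, e (ray q (n + a)) = ray q (n + b)) (v : TreeVertex q) :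
    act v (ofEquiv e he a b hray) = e v := rfl

theorem portrait_apply (g : AffTree q) (v : TreeVertex q) (t : Fin q) :
    portrait g v t = (act (v.child t) g).last := rfl

end AffTree

/-! ### Translations of labels and rotations below a vertex -/

namespace TreeVertex

variable {q : ℕ} [NeZero q]

/-- The translation of all labels by `n` places. -/
def shiftBy (n : ℤ) (v : TreeVertex q) : TreeVertex q where
  level := v.level + n
  digit k := v.digit (k - n)
  digit_above k hk := v.digit_above _ (by omega)
  digit_below := by
    obtain ⟨m, hm⟩ := v.digit_below
    exact ⟨m + n, fun k hk => hm _ (by omega)⟩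

/-- `w` is a strict descendant of `v`. -/
def Below (v w : TreeVertex q) : Prop :=
  v.level < w.level ∧ ∀ k ≤ v.level, w.digit k = v.digit k

/-- Apply `σ` to the letter that follows `v` in the label of each strict descendant of `v`. -/
noncomputable def rotate (v : TreeVertex q) (σ : Equiv.Perm (Fin q)) (w : TreeVertex q) :
    TreeVertex q where
  level := w.level
  digit := open Classical in
    if Below v w then
      Function.update w.digit (v.level + 1) (σ (w.digit (v.level + 1)))
    else w.digit
  digit_above k hk := by
    split_ifs with h
    · have := h.1
      rw [Function.update_of_ne (by omega)]
      exact w.digit_above k hk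
    · exact w.digit_above k hk
  digit_below := by
    obtain ⟨m, hm⟩ := w.digit_below
    refine ⟨min m v.level, fun k hk => ?_⟩
    split_ifs with h
    · rw [Function.update_of_ne (by omega)]
      exact hm k (by omega)
    · exact hm k (by omega)

theorem rotate_level (v : TreeVertex q) (σ : Equiv.Perm (Fin q)) (w : TreeVertex q) :
    (rotate v σ w).level = w.level := rfl

theorem rotate_of_not_below {v : TreeVertex q} (σ : Equiv.Perm (Fin q)) {w : TreeVertex q}
    (h : ¬ Below v w) : rotate v σ w = w := by
  ext k
  · rfl
  · rw [rotate]
    simp only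
    rw [if_neg h]

theorem rotate_digit_of_below {v : TreeVertex q} (σ : Equiv.Perm (Fin q)) {w : TreeVertex q}
    (h : Below v w) : (rotate v σ w).digit =
      Function.update w.digit (v.level + 1) (σ (w.digit (v.level + 1))) := by
  rw [rotate]
  simp only
  rw [if_pos h]

theorem below_rotate_iff (v : TreeVertex q) (σ : Equiv.Perm (Fin q)) (w : TreeVertex q) :
    Below v (rotate v σ w) ↔ Below v w := by
  by_cases h : Below v w
  · refine iff_of_true ⟨h.1, fun k hk => ?_⟩ h
    rw [rotate_digit_of_below σ h, Function.update_of_ne (by omega)]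
    exact h.2 k hk
  · rw [rotate_of_not_below σ h]

theorem rotate_rotate (v : TreeVertex q) (σ τ : Equiv.Perm (Fin q)) (w : TreeVertex q) :
    rotate v τ (rotate v σ w) = rotate v (τ * σ) w := by
  by_cases h : Below v w
  · refine TreeVertex.ext rfl ?_
    rw [rotate_digit_of_below _ ((below_rotate_iff v σ w).2 h), rotate_digit_of_below _ h,
      rotate_digit_of_below _ h]
    simp
  · rw [rotate_of_not_below σ h, rotate_of_not_below _ h, rotate_of_not_below _ h]

theorem rotate_one (v w : TreeVertex q) : rotate v 1 w = w := by
  by_cases h : Below v w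
  · refine TreeVertex.ext rfl ?_
    rw [rotate_digit_of_below _ h]
    simp
  · rw [rotate_of_not_below _ h]

/-- A strict descendant is a child or has a strict descendant as its first ancestor. -/
theorem below_child_iff (v w : TreeVertex q) (t : Fin q) :
    Below v (w.child t) ↔ w = v ∨ Below v w := by
  constructor
  · rintro ⟨h1, h2⟩
    simp only [child] at h1 h2
    by_cases hl : w.level = v.level
    · left
      refine TreeVertex.ext hl (funext fun k => ?_)
      by_cases hk : k ≤ v.level
      · rw [← h2 k hk, Function.update_of_ne (by omega)]
      · rw [v.digit_above k (by omega), w.digit_above k (by omega)]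
    · right
      refine ⟨by omega, fun k hk => ?_⟩
      rw [← h2 k hk, Function.update_of_ne (by omega)]
  · rintro (rfl | ⟨h1, h2⟩)
    · refine ⟨by simp [child], fun k hk => ?_⟩
      simp only [child]
      rw [Function.update_of_ne (by omega)]
    · refine ⟨by simp only [child]; omega, fun k hk => ?_⟩
      simp only [child]
      rw [Function.update_of_ne (by omega)]
      exact h2 k hk

theorem not_below_self (v : TreeVertex q) : ¬ Below v v := fun h => lt_irrefl _ h.1

/-- Together with `rotate_child_of_ne`, this gives the portrait of a rotation: `σ` at `v` and the
identity at every other vertex. -/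
theorem rotate_child_self (v : TreeVertex q) (σ : Equiv.Perm (Fin q)) (t : Fin q) :
    rotate v σ (v.child t) = v.child (σ t) := by
  refine TreeVertex.ext rfl ?_
  rw [rotate_digit_of_below _ ((below_child_iff v v t).2 (Or.inl rfl))]
  simp [child]

theorem rotate_child_of_ne {v w : TreeVertex q} (σ : Equiv.Perm (Fin q)) (h : w ≠ v)
    (t : Fin q) : rotate v σ (w.child t) = (rotate v σ w).child t := by
  by_cases hb : Below v w
  · refine TreeVertex.ext rfl ?_
    have hl := hb.1
    rw [rotate_digit_of_below _ ((below_child_iff v w t).2 (Or.inr hb))]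
    simp only [child, rotate_level, rotate_digit_of_below _ hb]
    rw [Function.update_of_ne (a := v.level + 1) (by omega),
      Function.update_comm (by omega)]
  · rw [rotate_of_not_below _ hb, rotate_of_not_below]
    rw [below_child_iff]
    tauto

theorem rotate_parent (v : TreeVertex q) (σ : Equiv.Perm (Fin q)) (w : TreeVertex q) :
    rotate v σ w.parent = (rotate v σ w).parent := by
  obtain ⟨u, t, rfl⟩ : ∃ u t, w = child u t := ⟨_, _, (child_last w).symm⟩
  rw [parent_child]
  by_cases h : u = v
  · subst h
    rw [rotate_child_self, parent_child, rotate_of_not_below _ (not_below_self u)]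
  · rw [rotate_child_of_ne _ h, parent_child]

end TreeVertex

/-! ### Explicit elements of the discrete affine group, transitivity, countability -/

namespace DATree

variable {q : ℕ} [NeZero q]

/-- The translation by one level, which has trivial portrait. -/
def shift (q : ℕ) [NeZero q] : DATree q :=
  ⟨AffTree.ofEquiv ⟨shiftBy 1, shiftBy (-1), fun v => by ext k <;> simp [shiftBy],
      fun v => by ext k <;> simp [shiftBy]⟩
    (fun v => by
      ext k
      · simp [shiftBy, parent]
      · simp only [shiftBy, parent, Equiv.coe_fn_mk, Function.update_apply]
        by_cases h : k = v.level + 1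
        · rw [if_pos h, if_pos (by omega)]
        · rw [if_neg h, if_neg (by omega)]) 1 0
    (fun n => by ext k <;> simp [shiftBy, ray]), by
    change {v | AffTree.portrait _ v ≠ 1}.Finite
    convert finite_empty (α := TreeVertex q)
    refine eq_empty_of_forall_notMem fun v hv => hv (Equiv.ext fun t => ?_)
    rw [AffTree.portrait_apply, AffTree.act_ofEquiv]
    simp [last, shiftBy, child]⟩

theorem act_shift (v : TreeVertex q) : AffTree.act v (shift q : AffTree q) = shiftBy 1 v := rfl

theorem vertical_shift : AffTree.vertical (shift q : AffTree q) = 1 := by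
  simp [AffTree.vertical, act_shift, shiftBy]

/-- The element with portrait `σ` at `v`, and trivial portrait elsewhere, that fixes `v`. -/
noncomputable def rotation (v : TreeVertex q) (σ : Equiv.Perm (Fin q)) : DATree q :=
  ⟨AffTree.ofEquiv ⟨rotate v σ, rotate v σ⁻¹,
      fun w => by rw [rotate_rotate, inv_mul_cancel, rotate_one],
      fun w => by rw [rotate_rotate, mul_inv_cancel, rotate_one]⟩ (rotate_parent v σ)
    -- From this index on, the ray lies at or above the horocycle of `v`, towards `ω`, so none of
    -- its vertices is a strict descendant of `v` and the rotation fixes them.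
    v.level.natAbs v.level.natAbs
    (fun n => rotate_of_not_below _ fun h => by
      have := h.1
      simp only [ray] at this
      omega), by
    change {w | AffTree.portrait _ w ≠ 1}.Finite
    refine (finite_singleton v).subset fun w hw => ?_
    by_contra h
    refine hw (Equiv.ext fun t => ?_)
    rw [AffTree.portrait_apply, AffTree.act_ofEquiv]
    change (rotate v σ (w.child t)).last = t
    rw [rotate_child_of_ne _ h, last_child]⟩

theorem act_rotation (v : TreeVertex q) (σ : Equiv.Perm (Fin q)) (w : TreeVertex q) :
    AffTree.act w (rotation v σ : AffTree q) = rotate v σ w := rfl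

theorem portrait_rotation_self (v : TreeVertex q) (σ : Equiv.Perm (Fin q)) :
    AffTree.portrait (rotation v σ : AffTree q) v = σ := by
  refine Equiv.ext fun t => ?_
  rw [AffTree.portrait_apply, act_rotation, rotate_child_self, last_child]

theorem act_rotation_self (v : TreeVertex q) (σ : Equiv.Perm (Fin q)) :
    AffTree.act v (rotation v σ : AffTree q) = v := by
  rw [act_rotation, rotate_of_not_below _ (not_below_self v)]

/-- The discrete affine group acts transitively on the vertices. -/
theorem exists_act_eq (v w : TreeVertex q) : ∃ g : DATree q, AffTree.act v (g : AffTree q) = w := by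
  have key : ∀ w : TreeVertex q, ∃ g : DATree q, AffTree.act (root q) (g : AffTree q) = w := by
    intro w
    induction w using child_induction with
    | hray n =>
      induction n with
      | zero => exact ⟨1, rfl⟩
      | succ n ih =>
        obtain ⟨g, hg⟩ := ih
        refine ⟨g * (shift q)⁻¹, ?_⟩
        change AffTree.act _ ((g : AffTree q) * (shift q : AffTree q)⁻¹) = _
        rw [AffTree.act_mul, hg]
        have : ray q n = AffTree.act (ray q (n + 1)) (shift q : AffTree q) := by
          rw [act_shift]
          ext k <;> simp [shiftBy, ray]
        rw [this, AffTree.act_inv_act]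
    | hchild w t ih =>
      obtain ⟨g, hg⟩ := ih
      -- The translation sends the root to its child `0`, `g` sends that child to some child of `w`,
      -- and the rotation at `w` corrects the last letter to `t`.
      refine ⟨shift q * g * rotation w (Equiv.swap
        (AffTree.portrait (g : AffTree q) (root q) 0) t), ?_⟩
      change AffTree.act _ ((shift q : AffTree q) * (g : AffTree q) * (rotation w _ : AffTree q)) = _
      rw [AffTree.act_mul, AffTree.act_mul, act_shift]
      have : shiftBy 1 (root q) = (root q).child 0 := by
        ext k
        · simp [shiftBy, child]
        · simp [shiftBy, child, root, ray]
      rw [this, AffTree.automata_rule, hg, act_rotation, rotate_child_self, Equiv.swap_apply_left]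
  obtain ⟨g, hg⟩ := key v
  obtain ⟨h, hh⟩ := key w
  refine ⟨g⁻¹ * h, ?_⟩
  change AffTree.act _ ((g : AffTree q)⁻¹ * (h : AffTree q)) = _
  rw [AffTree.act_mul, ← hg, AffTree.act_inv_act, hh]

instance : Countable (DATree q) := by
  classical
  -- An element is encoded by the image of the root and the finite graph of its portrait over the
  -- vertices where it is nontrivial.
  refine Function.Injective.countable
    (f := fun g : DATree q => (AffTree.act (root q) (g : AffTree q),
      (show {v | AffTree.portrait (g : AffTree q) v ≠ 1}.Finite from g.2).toFinset.image
        fun v => (v, AffTree.portrait (g : AffTree q) v))) fun g h e => ?_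
  rw [Prod.mk.injEq] at e
  have key : ∀ (g : DATree q) v σ, σ ≠ 1 → ((v, σ) ∈
      (show {v | AffTree.portrait (g : AffTree q) v ≠ 1}.Finite from g.2).toFinset.image
        (fun v => (v, AffTree.portrait (g : AffTree q) v)) ↔
          AffTree.portrait (g : AffTree q) v = σ) := by
    intro g v σ hσ
    simp only [Finset.mem_image, Finite.mem_toFinset, mem_ofPred_eq, Prod.mk.injEq]
    constructor
    · rintro ⟨w, -, rfl, h⟩
      exact h
    · rintro rfl
      exact ⟨v, hσ, rfl, rfl⟩
  refine Subtype.ext (AffTree.ext_portrait e.1 fun v => ?_)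
  by_cases hv : AffTree.portrait (h : AffTree q) v = 1
  · by_contra hne
    have := (key g v _ (fun h' => hne (h'.trans hv.symm))).2 rfl
    rw [e.2, key h v _ (fun h' => hne (h'.trans hv.symm))] at this
    exact hne this.symm
  · have := (key h v _ hv).2 rfl
    rwa [← e.2, key g v _ hv] at this

/-! ### Transience of the induced chain on the tree -/

open scoped ENNReal

/-- The expectation of `f` under the `n`-fold convolution power of `μ`. -/
noncomputable def expect (μ : PMF (DATree q)) (n : ℕ) (f : DATree q → ℝ≥0∞) : ℝ≥0∞ :=
  ∑' g, convPow μ n g * f g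

theorem tsum_bind_mul {α β : Type*} (p : PMF α) (k : α → PMF β) (F : β → ℝ≥0∞) :
    ∑' b, p.bind k b * F b = ∑' a, p a * ∑' b, k a b * F b := by
  simp only [PMF.bind_apply, ← ENNReal.tsum_mul_right, ← ENNReal.tsum_mul_left]
  rw [ENNReal.tsum_comm]
  simp only [mul_assoc]

theorem tsum_pure_mul {α : Type*} (a : α) (F : α → ℝ≥0∞) :
    ∑' b, PMF.pure a b * F b = F a := by
  rw [tsum_eq_single a fun b hb => by simp [PMF.pure_apply, hb]]
  simp

theorem tsum_map_mul {α β : Type*} (p : PMF α) (k : α → β) (F : β → ℝ≥0∞) :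
    ∑' b, p.map k b * F b = ∑' a, p a * F (k a) := by
  change ∑' b, p.bind (PMF.pure ∘ k) b * F b = _
  simp only [tsum_bind_mul, Function.comp_apply, tsum_pure_mul]

theorem expect_zero (μ : PMF (DATree q)) (f : DATree q → ℝ≥0∞) : expect μ 0 f = f 1 :=
  tsum_pure_mul 1 f

theorem expect_succ (μ : PMF (DATree q)) (n : ℕ) (f : DATree q → ℝ≥0∞) :
    expect μ (n + 1) f = ∑' h, μ h * expect μ n fun g => f (g * h) := by
  simp only [expect, convPow, tsum_bind_mul, tsum_map_mul, ← ENNReal.tsum_mul_left]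
  rw [ENNReal.tsum_comm]
  simp only [mul_left_comm]

/-- Convolution powers are built by adding a last factor; since left and right multiplications
commute, the first factor can be split off instead. Both forms are needed, for the starting point
and for the target. -/
theorem expect_succ' (μ : PMF (DATree q)) (n : ℕ) (f : DATree q → ℝ≥0∞) :
    expect μ (n + 1) f = ∑' h, μ h * expect μ n fun g => f (h * g) := by
  induction n generalizing f with
  | zero => simp [expect_succ, expect_zero]
  | succ n ih =>
    rw [expect_succ]
    conv_rhs => simp only [expect_succ μ n, ← ENNReal.tsum_mul_left]
    conv_lhs => simp only [ih, ← ENNReal.tsum_mul_left]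
    rw [ENNReal.tsum_comm]
    simp only [mul_left_comm (μ _) (μ _), mul_assoc]

theorem expect_add (μ : PMF (DATree q)) (n l : ℕ) (f : DATree q → ℝ≥0∞) :
    expect μ (n + l) f = ∑' h, convPow μ l h * expect μ n fun g => f (g * h) := by
  induction l generalizing f with
  | zero => exact (tsum_pure_mul 1 fun h => expect μ n fun g => f (g * h)).symm ▸ by simp
  | succ l ih =>
    change _ = expect μ (l + 1) fun h => expect μ n fun g => f (g * h)
    rw [← add_assoc, expect_succ, expect_succ]
    simp only [ih]
    simp only [expect, mul_assoc]

theorem expect_mono (μ : PMF (DATree q)) (n : ℕ) {f f' : DATree q → ℝ≥0∞} (h : ∀ g, f g ≤ f' g) :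
    expect μ n f ≤ expect μ n f' := by
  unfold expect
  gcongr with g
  exact h g

theorem expect_add_fun (μ : PMF (DATree q)) (n : ℕ) (f f' : DATree q → ℝ≥0∞) :
    (expect μ n fun g => f g + f' g) = expect μ n f + expect μ n f' := by
  simp only [expect, mul_add, ENNReal.tsum_add]

open Classical in
/-- The probability that the walk moves `v` to `u` at time `n`. -/
noncomputable def moves (μ : PMF (DATree q)) (v u : TreeVertex q) (n : ℕ) : ℝ≥0∞ :=
  expect μ n fun g => if AffTree.act v (g : AffTree q) = u then 1 else 0

theorem moves_le_one (μ : PMF (DATree q)) (v u : TreeVertex q) (n : ℕ) : moves μ v u n ≤ 1 := by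
  classical
  calc moves μ v u n ≤ expect μ n fun _ => 1 := expect_mono μ n fun g => by split_ifs <;> simp
    _ = 1 := by simp [expect, PMF.tsum_coe]

theorem moves_succ (μ : PMF (DATree q)) (v u : TreeVertex q) (n : ℕ) :
    moves μ v u (n + 1) = ∑' h : DATree q, μ h * moves μ (AffTree.act v (h : AffTree q)) u n :=
  expect_succ' μ n _

theorem moves_add (μ : PMF (DATree q)) (v u : TreeVertex q) (n l : ℕ) :
    moves μ v u (n + l) =
      ∑' h : DATree q, convPow μ l h * moves μ v (AffTree.act u (h : AffTree q)⁻¹) n := by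
  classical
  rw [moves, expect_add]
  refine tsum_congr fun h => ?_
  congr 2
  funext g
  refine if_congr ?_ rfl rfl
  change AffTree.act v ((g : AffTree q) * (h : AffTree q)) = u ↔ _
  rw [AffTree.act_mul]
  constructor
  · rintro rfl
    rw [AffTree.act_inv_act]
  · intro h'
    rw [h', AffTree.act_act_inv]

theorem moves_zero (μ : PMF (DATree q)) (v u : TreeVertex q) :
    moves μ v u 0 = open Classical in if v = u then 1 else 0 := by
  classical
  rw [moves, expect_zero]
  rfl

theorem tsum_mul_le (p : PMF (DATree q)) {F : DATree q → ℝ≥0∞} {b : ℝ≥0∞} (h : ∀ g, F g ≤ b) :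
    ∑' g, p g * F g ≤ b := by
  calc ∑' g, p g * F g ≤ ∑' g, p g * b := by gcongr with g; exact h g
    _ = b := by rw [ENNReal.tsum_mul_right, PMF.tsum_coe, one_mul]

/-- The maximum principle, for the dependence of the occupation times on the starting point. -/
theorem sum_moves_le_left (μ : PMF (DATree q)) (v u : TreeVertex q) (n : ℕ) :
    ∑ i ∈ Finset.range n, moves μ v u i ≤ ∑ i ∈ Finset.range n, moves μ u u i := by
  induction n generalizing v with
  | zero => simp
  | succ n ih =>
    by_cases hv : v = u
    · rw [hv]
    · rw [Finset.sum_range_succ', moves_zero, if_neg hv, add_zero]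
      simp only [moves_succ]
      rw [← Summable.tsum_finsetSum fun _ _ => ENNReal.summable]
      simp only [← Finset.mul_sum]
      refine (tsum_mul_le μ fun g => ih _).trans ?_
      rw [Finset.sum_range_succ]
      exact le_self_add

/-- The maximum principle, for the dependence of the occupation times on the target. -/
theorem sum_moves_le_right (μ : PMF (DATree q)) (v u : TreeVertex q) (n : ℕ) :
    ∑ i ∈ Finset.range n, moves μ v u i ≤ ∑ i ∈ Finset.range n, moves μ v v i := by
  induction n generalizing u with
  | zero => simp
  | succ n ih =>
    by_cases hv : v = u
    · rw [hv]
    · rw [Finset.sum_range_succ', moves_zero, if_neg hv, add_zero]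
      -- Conditioning on the last increment `h`: to be at `u` is to have been at `u.h⁻¹` one step
      -- before, since `h` acts bijectively. Hence the occupation time is an average over targets.
      simp only [moves_add μ v u _ 1]
      rw [← Summable.tsum_finsetSum fun _ _ => ENNReal.summable]
      simp only [← Finset.mul_sum]
      refine (tsum_mul_le _ fun g => ih _).trans ?_
      rw [Finset.sum_range_succ]
      exact le_self_add

/-- Moving `u` to one of its children amounts to moving its first ancestor to `u`. -/
theorem moves_child_add_le (μ : PMF (DATree q)) (u : TreeVertex q) {s t : Fin q} (hst : s ≠ t)
    (n : ℕ) : moves μ u (u.child s) n + moves μ u (u.child t) n ≤ moves μ u.parent u n := by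
  classical
  rw [moves, moves, moves, ← expect_add_fun]
  refine expect_mono μ n fun g => ?_
  have hp := AffTree.act_parent u (g : AffTree q)
  by_cases h1 : AffTree.act u (g : AffTree q) = u.child s
  · rw [h1, parent_child] at hp
    have hne : u.child s ≠ u.child t := fun h => hst (by simpa using congrArg last h)
    rw [if_pos h1, if_pos hp, h1, if_neg hne, add_zero]
  · rw [if_neg h1, zero_add]
    by_cases h2 : AffTree.act u (g : AffTree q) = u.child t
    · rw [h2, parent_child] at hp
      rw [if_pos h2, if_pos hp]
    · rw [if_neg h2]
      exact zero_le

theorem sum_moves_lt_top (μ : PMF (DATree q)) (v u : TreeVertex q) (n : ℕ) :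
    ∑ i ∈ Finset.range n, moves μ v u i < ∞ :=
  ENNReal.sum_lt_top.2 fun i _ => (moves_le_one μ v u i).trans_lt ENNReal.one_lt_top

/-- Every vertex is transient for the induced chain on the tree. -/
theorem tsum_moves_lt_top (hq : 2 ≤ q) {μ : PMF (DATree q)} (hμ : Aperiodic μ)
    (v u : TreeVertex q) : ∑' n, moves μ v u n < ∞ := by
  classical
  let s : Fin q := ⟨0, by omega⟩
  let t : Fin q := ⟨1, by omega⟩
  have hst : s ≠ t := by simp [s, t, Fin.ext_iff]
  obtain ⟨g, hg⟩ := exists_act_eq (u.child s) u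
  obtain ⟨h, hh⟩ := exists_act_eq (u.child t) u
  have hgh : g ≠ h := by
    rintro rfl
    have := AffTree.act_injective (g : AffTree q) (hg.trans hh.symm)
    exact hst (by simpa using congrArg last this)
  -- The two elements must be charged at the same time `l`, so that both losses occur in one
  -- average.
  obtain ⟨l, -, hlg, hlh⟩ := hμ g h
  set c := min (convPow μ l g) (convPow μ l h) with hc
  have hc0 : c ≠ 0 := by
    rw [PMF.mem_support_iff] at hlg hlh
    rw [hc]
    rcases min_choice (convPow μ l g) (convPow μ l h) with h' | h' <;> rw [h'] <;> assumption
  have key : ∀ n, c * ∑ i ∈ Finset.range n, moves μ u u i ≤ l := by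
    intro n
    -- Truncating at time `n` keeps `b` finite, so that it can be cancelled at the end; the bound
    -- obtained does not depend on `n`.
    set b := ∑ i ∈ Finset.range n, moves μ u u i with hb
    set B : DATree q → ℝ≥0∞ := fun k =>
      ∑ i ∈ Finset.range n, moves μ u (AffTree.act u (k : AffTree q)⁻¹) i with hB
    have hBb : ∀ k, B k ≤ b := fun k => sum_moves_le_right μ u _ n
    have hbtop : b ≠ ∞ := (sum_moves_lt_top μ u u n).ne
    have hBg : B g = ∑ i ∈ Finset.range n, moves μ u (u.child s) i := by
      have e : AffTree.act u (g : AffTree q)⁻¹ = u.child s := by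
        conv_lhs => rw [← hg, AffTree.act_inv_act]
      simp only [hB, e]
    have hBh : B h = ∑ i ∈ Finset.range n, moves μ u (u.child t) i := by
      have e : AffTree.act u (h : AffTree q)⁻¹ = u.child t := by
        conv_lhs => rw [← hh, AffTree.act_inv_act]
      simp only [hB, e]
    have hsum : B g + B h ≤ b := by
      rw [hBg, hBh, ← Finset.sum_add_distrib]
      exact (Finset.sum_le_sum fun i _ => moves_child_add_le μ u hst i).trans
        (sum_moves_le_left μ _ u n)
    have hstep : ∑ i ∈ Finset.range n, moves μ u u (i + l) = ∑' k, convPow μ l k * B k := by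
      simp only [moves_add μ u u _ l]
      rw [← Summable.tsum_finsetSum fun _ _ => ENNReal.summable]
      simp only [← Finset.mul_sum, hB]
    -- The first `l` probabilities cost at most `1` each; the others are conditioned on their last
    -- `l` increments.
    have hle : b ≤ l + ∑' k, convPow μ l k * B k := by
      rw [← hstep, hb]
      calc ∑ i ∈ Finset.range n, moves μ u u i
          ≤ ∑ i ∈ Finset.range (l + n), moves μ u u i :=
            Finset.sum_le_sum_of_subset (Finset.range_subset_range.2 (by omega))
        _ = ∑ i ∈ Finset.range l, moves μ u u i + ∑ i ∈ Finset.range n, moves μ u u (i + l) := by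
            rw [Finset.sum_range_add]
            simp only [add_comm]
        _ ≤ l + ∑ i ∈ Finset.range n, moves μ u u (i + l) := by
            gcongr
            exact (Finset.sum_le_sum fun i _ => moves_le_one μ u u i).trans (by simp)
    -- Every `B k` is at most `b`, but `B g + B h ≤ b` instead of `2 * b`. As `g` and `h` both have
    -- weight at least `c`, the average falls short of `b` by at least `c * b`.
    have hloss : ∑' k, convPow μ l k * B k + c * b ≤ b := by
      have hpt : ∀ k, convPow μ l k * B k + ((if k = g then c * (b - B g) else 0) +
          (if k = h then c * (b - B h) else 0)) ≤ convPow μ l k * b := by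
        intro k
        by_cases hkg : k = g
        · subst hkg
          rw [if_pos rfl, if_neg hgh, add_zero]
          calc _ ≤ convPow μ l k * B k + convPow μ l k * (b - B k) := by
                gcongr
                exact min_le_left _ _
            _ = _ := by rw [← mul_add, add_tsub_cancel_of_le (hBb k)]
        · rw [if_neg hkg, zero_add]
          by_cases hkh : k = h
          · subst hkh
            rw [if_pos rfl]
            calc _ ≤ convPow μ l k * B k + convPow μ l k * (b - B k) := by
                  gcongr
                  exact min_le_right _ _
              _ = _ := by rw [← mul_add, add_tsub_cancel_of_le (hBb k)]
          · rw [if_neg hkh, add_zero]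
            gcongr
            exact hBb k
      have hgain : c * b ≤ c * (b - B g) + c * (b - B h) := by
        rw [← mul_add]
        gcongr
        calc b = (b - B g) + B g := (tsub_add_cancel_of_le (hBb g)).symm
          _ ≤ (b - B g) + (b - B h) := by
            gcongr
            exact ENNReal.le_sub_of_add_le_right ((hBb h).trans_lt hbtop.lt_top).ne hsum
      calc _ ≤ ∑' k, convPow μ l k * B k + (c * (b - B g) + c * (b - B h)) := by gcongr
        _ = ∑' k, (convPow μ l k * B k + ((if k = g then c * (b - B g) else 0) +
              (if k = h then c * (b - B h) else 0))) := by
            rw [ENNReal.tsum_add, ENNReal.tsum_add, tsum_ite_eq, tsum_ite_eq]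
        _ ≤ ∑' k, convPow μ l k * b := ENNReal.tsum_le_tsum hpt
        _ = b := by rw [ENNReal.tsum_mul_right, PMF.tsum_coe, one_mul]
    have hfin : b + c * b ≤ b + l := by
      calc b + c * b ≤ l + ∑' k, convPow μ l k * B k + c * b := by gcongr
        _ = l + (∑' k, convPow μ l k * B k + c * b) := add_assoc _ _ _
        _ ≤ l + b := by gcongr
        _ = b + l := add_comm _ _
    exact (ENNReal.add_le_add_iff_left hbtop).1 hfin
  have hbound : ∀ n, ∑ i ∈ Finset.range n, moves μ v u i ≤ l / c := fun n =>
    (sum_moves_le_left μ v u n).trans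
      ((ENNReal.le_div_iff_mul_le (Or.inl hc0) (Or.inr (ENNReal.natCast_ne_top l))).2
        (by rw [mul_comm]; exact key n))
  refine (ENNReal.tsum_le_of_sum_range_le hbound).trans_lt ?_
  exact ENNReal.div_lt_top (ENNReal.natCast_ne_top l) hc0

end DATree

/-! ### The law of the increments and the Markov property -/

instance (q : ℕ) : DiscreteMeasurableSpace (Equiv.Perm (Fin q)) := ⟨fun _ => trivial⟩

instance (q : ℕ) [NeZero q] : DiscreteMeasurableSpace (DATree q) := ⟨fun _ => trivial⟩

namespace DATree

variable {q : ℕ} [NeZero q]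

open scoped ENNReal

instance (μ : PMF (DATree q)) : IsProbabilityMeasure (incrementLaw μ) :=
  inferInstanceAs (IsProbabilityMeasure (Measure.infinitePi _))

/-- Prepend an increment to a sequence. -/
def cons (g : DATree q) (x : ℕ → DATree q) : ℕ → DATree q
  | 0 => g
  | n + 1 => x n

theorem measurable_cons : Measurable fun p : DATree q × (ℕ → DATree q) => cons p.1 p.2 := by
  refine measurable_pi_iff.2 fun n => ?_
  cases n with
  | zero => exact measurable_fst
  | succ n => exact (measurable_pi_apply n).comp measurable_snd

theorem cons_zero_shift (x : ℕ → DATree q) : cons (x 0) (fun n => x (n + 1)) = x := by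
  funext n
  cases n <;> rfl

/-- A product measure is determined by its values on finite boxes, and a box pulls back under `cons`
to the product of its side at `0` and a box with indices lowered by one. -/
theorem map_cons_incrementLaw (μ : PMF (DATree q)) :
    (μ.toMeasure.prod (incrementLaw μ)).map (fun p => cons p.1 p.2) = incrementLaw μ := by
  refine Measure.eq_infinitePi _ fun s t ht => ?_
  rw [Measure.map_apply measurable_cons (MeasurableSet.pi s.countable_toSet fun i _ => ht i)]
  classical
  have e : (fun p : DATree q × (ℕ → DATree q) => cons p.1 p.2) ⁻¹' (Set.pi s t) =
      (if 0 ∈ s then t 0 else univ) ×ˢ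
        (Set.pi ((s.erase 0).image Nat.pred) fun i => t (i + 1)) := by
    ext ⟨g, x⟩
    simp only [mem_preimage, Set.mem_pi, Finset.mem_coe, mem_prod, Finset.mem_image,
      Finset.mem_erase]
    constructor
    · intro h
      refine ⟨?_, ?_⟩
      · split_ifs with h0
        · exact h 0 h0
        · trivial
      · rintro i ⟨j, ⟨hj, hjs⟩, rfl⟩
        obtain ⟨k, rfl⟩ := Nat.exists_eq_succ_of_ne_zero hj
        exact h _ hjs
    · rintro ⟨h0, h⟩ i hi
      cases i with
      | zero => rwa [if_pos hi] at h0
      | succ i => exact h i ⟨i + 1, ⟨by omega, hi⟩, rfl⟩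
  rw [e, Measure.prod_prod, incrementLaw, Measure.infinitePi_pi _ fun i _ => ht _,
    Finset.prod_image]
  · have hprod : ∏ i ∈ s.erase 0, μ.toMeasure (t (i.pred + 1)) =
        ∏ i ∈ s.erase 0, μ.toMeasure (t i) := by
      refine Finset.prod_congr rfl fun i hi => ?_
      rw [Nat.pred_eq_sub_one, Nat.sub_add_cancel (Nat.pos_of_ne_zero (Finset.mem_erase.1 hi).1)]
    rw [hprod]
    split_ifs with h0
    · exact Finset.mul_prod_erase s (fun i => μ.toMeasure (t i)) h0
    · rw [Finset.erase_eq_of_notMem h0, measure_univ, one_mul]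
  · intro i hi j hj hij
    have := (Finset.mem_erase.1 hi).1
    have := (Finset.mem_erase.1 hj).1
    simp only [Nat.pred_eq_sub_one] at hij
    omega

theorem lintegral_toMeasure (μ : PMF (DATree q)) (f : DATree q → ℝ≥0∞) :
    ∫⁻ g, f g ∂μ.toMeasure = ∑' g, μ g * f g := by
  rw [lintegral_countable']
  refine tsum_congr fun g => ?_
  rw [PMF.toMeasure_apply_singleton _ _ (measurableSet_singleton g), mul_comm]

/-- The decomposition of the law of the increments according to the first one. -/
theorem lintegral_incrementLaw (μ : PMF (DATree q)) {F : (ℕ → DATree q) → ℝ≥0∞}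
    (hF : Measurable F) : ∫⁻ x, F x ∂incrementLaw μ =
      ∑' g, μ g * ∫⁻ x, F (cons g x) ∂incrementLaw μ := by
  conv_lhs => rw [← map_cons_incrementLaw]
  rw [lintegral_map hF measurable_cons, lintegral_prod (fun p => F (cons p.1 p.2))
    (hF.comp measurable_cons).aemeasurable, lintegral_toMeasure]

theorem incrementLaw_apply (μ : PMF (DATree q)) {A : Set (ℕ → DATree q)} (hA : MeasurableSet A) :
    incrementLaw μ A = ∑' g, μ g * incrementLaw μ (cons g ⁻¹' A) := by
  have hc : ∀ g : DATree q, Measurable (cons g) := fun g => measurable_cons.comp measurable_prodMk_left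
  rw [← lintegral_indicator_one hA, lintegral_incrementLaw μ (measurable_one.indicator hA)]
  refine tsum_congr fun g => ?_
  rw [← lintegral_indicator_one (hc g hA)]
  rfl

theorem walk_cons (g : DATree q) (x : ℕ → DATree q) (n : ℕ) :
    walk (cons g x) (n + 1) = g * walk x n := by
  induction n with
  | zero => change 1 * g = g * 1; simp
  | succ n ih =>
    rw [walk, ih, walk, mul_assoc]
    rfl

theorem measurable_walk (n : ℕ) : Measurable fun x : ℕ → DATree q => walk x n := by
  induction n with
  | zero => exact measurable_const
  | succ n ih =>
    exact (Measurable.of_discrete (f := fun p : DATree q × DATree q => p.1 * p.2)).comp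
      (ih.prodMk (measurable_pi_apply n))

theorem measurable_shift (n : ℕ) : Measurable fun (x : ℕ → DATree q) i => x (i + n) :=
  measurable_pi_iff.2 fun i => measurable_pi_apply (i + n)

/-- At a fixed time, the future increments are independent of the walk. -/
theorem lintegral_walk_shift (μ : PMF (DATree q)) (n : ℕ)
    {F : DATree q → (ℕ → DATree q) → ℝ≥0∞} (hF : ∀ g, Measurable (F g)) :
    ∫⁻ x, F (walk x n) (fun i => x (i + n)) ∂incrementLaw μ =
      expect μ n fun g => ∫⁻ x, F g x ∂incrementLaw μ := by
  have hF' : Measurable fun p : DATree q × (ℕ → DATree q) => F p.1 p.2 :=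
    measurable_from_prod_countable_right hF
  induction n generalizing F with
  | zero => rw [expect_zero]; rfl
  | succ n ih =>
    rw [lintegral_incrementLaw, expect_succ']
    · refine tsum_congr fun h => ?_
      congr 1
      simp only [walk_cons]
      exact ih (F := fun g => F (h * g)) (fun g => hF _)
        (measurable_from_prod_countable_right fun g => hF (h * g))
    · exact hF'.comp ((measurable_walk (n + 1)).prodMk (measurable_shift (n + 1)))

theorem measure_act_walk (μ : PMF (DATree q)) (v u : TreeVertex q) (n : ℕ) :
    incrementLaw μ {x | AffTree.act v (walk x n : AffTree q) = u} = moves μ v u n := by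
  classical
  have hm : MeasurableSet {x : ℕ → DATree q | AffTree.act v (walk x n : AffTree q) = u} :=
    measurable_walk n (MeasurableSet.of_discrete (s := {g : DATree q | AffTree.act v g = u}))
  rw [← lintegral_indicator_one hm, moves]
  have := lintegral_walk_shift μ n
    (F := fun g _ => if AffTree.act v (g : AffTree q) = u then 1 else 0) fun g => measurable_const
  simp only [lintegral_const, measure_univ, mul_one] at this
  rw [← this]
  rfl

theorem map_eval_incrementLaw (μ : PMF (DATree q)) (n : ℕ) :
    (incrementLaw μ).map (fun x => x n) = μ.toMeasure :=
  Measure.infinitePi_map_eval (fun _ : ℕ => μ.toMeasure) n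

theorem ae_toMeasure_mem_support (μ : PMF (DATree q)) : ∀ᵐ g ∂μ.toMeasure, g ∈ μ.support := by
  rw [ae_iff]
  exact (PMF.toMeasure_apply_eq_zero_iff _ MeasurableSet.of_discrete).2
    (disjoint_left.2 fun g hg h => h hg)

/-- All increments lie in the support of their law. -/
theorem ae_mem_support (μ : PMF (DATree q)) : ∀ᵐ x ∂incrementLaw μ, ∀ n, x n ∈ μ.support := by
  refine ae_all_iff.2 fun n => ?_
  have h := ae_toMeasure_mem_support μ
  rw [← map_eval_incrementLaw μ n] at h
  exact ae_of_ae_map (measurable_pi_apply n).aemeasurable h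

/-- Almost surely the walk moves `v` to `u` finitely many times only. -/
theorem ae_eventually_act_ne (hq : 2 ≤ q) {μ : PMF (DATree q)} (hμ : Aperiodic μ) :
    ∀ᵐ x ∂incrementLaw μ, ∀ v u, ∀ᶠ n in atTop, AffTree.act v (walk x n : AffTree q) ≠ u := by
  refine ae_all_iff.2 fun v => ae_all_iff.2 fun u => ?_
  refine ae_eventually_notMem (s := fun n => {x : ℕ → DATree q | AffTree.act v (walk x n : AffTree q) = u}) ?_
  simp only [measure_act_walk]
  exact (tsum_moves_lt_top hq hμ v u).ne

/-! ### Stabilization of the portraits and the final configuration -/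

theorem portrait_walk_succ (x : ℕ → DATree q) (n : ℕ) (v : TreeVertex q) :
    AffTree.portrait (walk x (n + 1) : AffTree q) v =
      AffTree.portrait (x n : AffTree q) (AffTree.act v (walk x n : AffTree q)) *
        AffTree.portrait (walk x n : AffTree q) v :=
  AffTree.portrait_mul _ _ _

/-- The vertices where some element of the support of `μ` has a nontrivial portrait. -/
def portraitSupport (μ : PMF (DATree q)) : Set (TreeVertex q) :=
  ⋃ g ∈ μ.support, {v | AffTree.portrait (g : AffTree q) v ≠ 1}

theorem portraitSupport_finite {μ : PMF (DATree q)} (hfin : μ.support.Finite) :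
    (portraitSupport μ).Finite :=
  hfin.biUnion fun g _ => g.2

theorem portrait_walk_succ_eq {μ : PMF (DATree q)} {x : ℕ → DATree q} {n : ℕ} {v : TreeVertex q}
    (hx : x n ∈ μ.support) (hv : AffTree.act v (walk x n : AffTree q) ∉ portraitSupport μ) :
    AffTree.portrait (walk x (n + 1) : AffTree q) v =
      AffTree.portrait (walk x n : AffTree q) v := by
  have : AffTree.portrait (x n : AffTree q) (AffTree.act v (walk x n : AffTree q)) = 1 := by
    by_contra h
    exact hv (mem_biUnion hx h)
  rw [portrait_walk_succ, this, one_mul]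

/-- The portraits stabilize at every vertex. -/
def Stabilizes (x : ℕ → DATree q) : Prop := ∀ v, ∃ σ, StabilizesTo x v σ

/-- By transience the trajectory of `v` leaves the finite set `portraitSupport μ` for good, and from
then on its portrait is frozen. -/
theorem ae_stabilizes (hq : 2 ≤ q) {μ : PMF (DATree q)} (hfin : μ.support.Finite)
    (hμ : Aperiodic μ) : ∀ᵐ x ∂incrementLaw μ, Stabilizes x := by
  filter_upwards [ae_mem_support μ, ae_eventually_act_ne hq hμ] with x hx hx' v
  have hev : ∀ᶠ n in atTop, ∀ u ∈ portraitSupport μ, AffTree.act v (walk x n : AffTree q) ≠ u :=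
    (Filter.eventually_all_finite (portraitSupport_finite hfin)).2 fun u _ => hx' v u
  obtain ⟨N, hN⟩ := eventually_atTop.1 hev
  refine ⟨AffTree.portrait (walk x N : AffTree q) v, eventually_atTop.2 ⟨N, fun n hn => ?_⟩⟩
  induction n, hn using Nat.le_induction with
  | base => rfl
  | succ n hn ih =>
    rw [portrait_walk_succ_eq (hx n) fun h => hN n hn _ h rfl, ih]

theorem StabilizesTo.unique {x : ℕ → DATree q} {v : TreeVertex q} {σ τ : Equiv.Perm (Fin q)}
    (hσ : StabilizesTo x v σ) (hτ : StabilizesTo x v τ) : σ = τ := by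
  obtain ⟨n, h1, h2⟩ := (hσ.and hτ).exists
  exact h1.symm.trans h2

theorem StabilizesTo.finalConfig_eq {x : ℕ → DATree q} {v : TreeVertex q}
    {σ : Equiv.Perm (Fin q)} (h : StabilizesTo x v σ) : finalConfig x v = σ := by
  have h' : ∃ σ, StabilizesTo x v σ := ⟨σ, h⟩
  rw [finalConfig, dif_pos h']
  exact h'.choose_spec.unique h

theorem stabilizesTo_cons_iff (g : DATree q) (x : ℕ → DATree q) (v : TreeVertex q)
    (σ : Equiv.Perm (Fin q)) : StabilizesTo (cons g x) v (σ * AffTree.portrait (g : AffTree q) v) ↔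
      StabilizesTo x (AffTree.act v (g : AffTree q)) σ := by
  rw [StabilizesTo, ← map_add_atTop_eq_nat 1, eventually_map, StabilizesTo]
  refine eventually_congr (Eventually.of_forall fun n => ?_)
  rw [walk_cons]
  change AffTree.portrait ((g : AffTree q) * (walk x n : AffTree q)) v = _ ↔ _
  rw [AffTree.portrait_mul, mul_left_inj]

theorem stabilizes_cons_iff (g : DATree q) (x : ℕ → DATree q) :
    Stabilizes (cons g x) ↔ Stabilizes x := by
  constructor
  · intro h v
    obtain ⟨σ, hσ⟩ := h (AffTree.act v (g : AffTree q)⁻¹)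
    refine ⟨σ * (AffTree.portrait (g : AffTree q) (AffTree.act v (g : AffTree q)⁻¹))⁻¹, ?_⟩
    rw [← AffTree.act_act_inv v (g : AffTree q), ← stabilizesTo_cons_iff]
    rwa [AffTree.act_act_inv, inv_mul_cancel_right]
  · intro h v
    obtain ⟨σ, hσ⟩ := h (AffTree.act v (g : AffTree q))
    exact ⟨_, (stabilizesTo_cons_iff g x v σ).2 hσ⟩

theorem finalConfig_cons (g : DATree q) {x : ℕ → DATree q} (h : Stabilizes x) (v : TreeVertex q) :
    finalConfig (cons g x) v =
      finalConfig x (AffTree.act v (g : AffTree q)) * AffTree.portrait (g : AffTree q) v := by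
  obtain ⟨σ, hσ⟩ := h (AffTree.act v (g : AffTree q))
  rw [((stabilizesTo_cons_iff g x v σ).2 hσ).finalConfig_eq, hσ.finalConfig_eq]

theorem measurableSet_stabilizesTo (v : TreeVertex q) (σ : Equiv.Perm (Fin q)) :
    MeasurableSet {x : ℕ → DATree q | StabilizesTo x v σ} := by
  have : {x : ℕ → DATree q | StabilizesTo x v σ} = ⋃ N : ℕ, ⋂ n : ℕ, ⋂ _ : N ≤ n,
      (fun x => walk x n) ⁻¹' {g : DATree q | AffTree.portrait (g : AffTree q) v = σ} := by
    ext x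
    simp [StabilizesTo, eventually_atTop]
  rw [this]
  exact .iUnion fun N => .iInter fun n => .iInter fun _ => measurable_walk n .of_discrete

theorem measurableSet_stabilizes : MeasurableSet {x : ℕ → DATree q | Stabilizes x} := by
  have : {x : ℕ → DATree q | Stabilizes x} =
      ⋂ v, ⋃ σ, {x : ℕ → DATree q | StabilizesTo x v σ} := by
    ext x
    simp [Stabilizes]
  rw [this]
  exact .iInter fun v => .iUnion fun σ => measurableSet_stabilizesTo v σ

theorem measurable_finalConfig : Measurable (finalConfig : (ℕ → DATree q) → TreeConfig q) := by
  refine measurable_pi_iff.2 fun v => measurable_to_countable' fun σ => ?_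
  have : (fun x : ℕ → DATree q => finalConfig x v) ⁻¹' {σ} =
      -- The second set accounts for the default value `1` where there is no limit.
      {x | StabilizesTo x v σ} ∪ ({x | σ = 1} ∩ ⋂ τ, {x | StabilizesTo x v τ}ᶜ) := by
    ext x
    simp only [mem_preimage, mem_singleton_iff, mem_union, mem_ofPred_eq, mem_inter_iff, mem_iInter,
      mem_compl_iff]
    by_cases h : ∃ τ, StabilizesTo x v τ
    · obtain ⟨τ, hτ⟩ := h
      rw [hτ.finalConfig_eq]
      constructor
      · rintro rfl
        exact Or.inl hτ
      · rintro (h | h)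
        · exact hτ.unique h
        · exact absurd hτ (h.2 τ)
    · rw [finalConfig, dif_neg h]
      push Not at h
      constructor
      · exact fun e => Or.inr ⟨e.symm, h⟩
      · rintro (h' | h')
        · exact absurd h' (h σ)
        · exact h'.1.symm
  rw [this]
  exact (measurableSet_stabilizesTo v σ).union
    ((MeasurableSet.const _).inter (.iInter fun τ => (measurableSet_stabilizesTo v τ).compl))

instance (μ : PMF (DATree q)) : IsProbabilityMeasure (harmonicMeasure μ) :=
  Measure.isProbabilityMeasure_map measurable_finalConfig.aemeasurable

theorem finalConfig_shift (n : ℕ) {x : ℕ → DATree q} (h : Stabilizes x) (v : TreeVertex q) :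
    finalConfig x v =
      finalConfig (fun i => x (i + n)) (AffTree.act v (walk x n : AffTree q)) *
        AffTree.portrait (walk x n : AffTree q) v := by
  induction n generalizing x v with
  | zero =>
    change _ = finalConfig x v * AffTree.portrait (1 : AffTree q) v
    rw [AffTree.portrait_one, mul_one]
  | succ n ih =>
    have hs : Stabilizes fun n => x (n + 1) := by
      rw [← stabilizes_cons_iff (x 0), cons_zero_shift]
      exact h
    have hw : walk x (n + 1) = x 0 * walk (fun n => x (n + 1)) n := by
      rw [← walk_cons, cons_zero_shift]
    have e : (walk x (n + 1) : AffTree q) =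
        (x 0 : AffTree q) * (walk (fun n => x (n + 1)) n : AffTree q) := by
      rw [hw]
      rfl
    conv_lhs => rw [← cons_zero_shift x, finalConfig_cons _ hs, ih hs, mul_assoc]
    rw [e, AffTree.portrait_mul, AffTree.act_mul]
    rfl

/-! ### Nontrivial final values at prescribed levels -/

theorem measurable_finalConfig_apply (v : TreeVertex q) :
    Measurable fun x : ℕ → DATree q => finalConfig x v :=
  (measurable_pi_apply v).comp measurable_finalConfig

/-- The final value at the root is not deterministic. -/
theorem measure_finalConfig_root_ne (hq : 2 ≤ q) {μ : PMF (DATree q)} (hfin : μ.support.Finite)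
    (hμ : Aperiodic μ) (σ : Equiv.Perm (Fin q)) :
    incrementLaw μ {x | finalConfig x (root q) ≠ σ} ≠ 0 := by
  intro h0
  let τ : Equiv.Perm (Fin q) := Equiv.swap ⟨0, by omega⟩ ⟨1, by omega⟩
  have hτ : τ ≠ 1 := by
    intro h
    have := congrArg (fun π => π ⟨0, by omega⟩) h
    simp [τ, Fin.ext_iff] at this
  -- Both elements fix the root, but their portraits there differ by `τ`. If the final value were
  -- always `σ`, the increments after time `l` would have to produce both `σ` and `σ * τ⁻¹` at the
  -- root.
  obtain ⟨l, -, h1, h2⟩ := hμ 1 (rotation (root q) τ)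
  let A : DATree q → Set (ℕ → DATree q) := fun g =>
    {x | finalConfig x (AffTree.act (root q) (g : AffTree q)) *
      AffTree.portrait (g : AffTree q) (root q) ≠ σ}
  have hA : ∀ g, MeasurableSet (A g) := fun g =>
    measurable_finalConfig_apply _ (MeasurableSet.of_discrete
      (s := {π | π * AffTree.portrait (g : AffTree q) (root q) ≠ σ}))
  have hint : ∫⁻ x, (A (walk x l)).indicator 1 (fun i => x (i + l)) ∂incrementLaw μ = 0 := by
    have : ∀ᵐ x ∂incrementLaw μ, finalConfig x (root q) = σ := by
      rw [ae_iff]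
      exact h0
    rw [lintegral_congr_ae (g := fun _ => 0), lintegral_zero]
    filter_upwards [this, ae_stabilizes hq hfin hμ] with x hx hs
    have hx := (finalConfig_shift l hs (root q)).symm.trans hx
    exact indicator_of_notMem (s := A (walk x l)) (fun h => h hx) _
  rw [lintegral_walk_shift μ l (F := fun g => (A g).indicator 1)
    fun g => measurable_one.indicator (hA g), expect, ENNReal.tsum_eq_zero] at hint
  have key : ∀ g ∈ (convPow μ l).support, ∀ᵐ x ∂incrementLaw μ, x ∉ A g := by
    intro g hg
    have := (mul_eq_zero.1 (hint g)).resolve_left hg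
    rw [lintegral_indicator_one (hA g)] at this
    exact measure_eq_zero_iff_ae_notMem.1 this
  obtain ⟨x, hx1, hx2⟩ := ((key _ h1).and (key _ h2)).exists
  simp only [A, mem_ofPred_eq, not_not] at hx1 hx2
  rw [act_rotation_self, portrait_rotation_self] at hx2
  change finalConfig x (root q) * AffTree.portrait (1 : AffTree q) (root q) = σ at hx1
  rw [AffTree.portrait_one, mul_one] at hx1
  rw [hx1] at hx2
  exact hτ (mul_eq_left.1 hx2)

/-- Finiteness of the symmetric group makes the bound uniform in `σ`. This matters because `σ` will
be the inverse of the portrait accumulated when a vertex reaches the root. -/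
theorem exists_le_measure_finalConfig_root_ne (hq : 2 ≤ q) {μ : PMF (DATree q)}
    (hfin : μ.support.Finite) (hμ : Aperiodic μ) :
    ∃ ε : ℝ≥0∞, ε ≠ 0 ∧ ∀ σ, ε ≤ incrementLaw μ {x | finalConfig x (root q) ≠ σ} := by
  obtain ⟨σ, hσ⟩ := Finite.exists_min fun σ : Equiv.Perm (Fin q) =>
    incrementLaw μ {x | finalConfig x (root q) ≠ σ}
  exact ⟨_, measure_finalConfig_root_ne hq hfin hμ σ, hσ⟩

theorem vertical_mul (g h : DATree q) : AffTree.vertical ((g * h : DATree q) : AffTree q) =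
    AffTree.vertical (g : AffTree q) + AffTree.vertical (h : AffTree q) :=
  AffTree.vertical_mul _ _

/-- If the walk, started at `g`, moves a vertex at a level in `L` to the root by the time `N`, then
with probability at least `ε` some vertex at a level in `L` gets a nontrivial final value. -/
theorem mul_measure_hit_le (hq : 2 ≤ q) {μ : PMF (DATree q)} (hfin : μ.support.Finite)
    (hμ : Aperiodic μ) {ε : ℝ≥0∞}
    (hε : ∀ σ, ε ≤ incrementLaw μ {x | finalConfig x (root q) ≠ σ}) (L : ℤ → Prop) (N : ℕ)
    (g : DATree q) :
    ε * incrementLaw μ {x | ∃ n < N, L (-(AffTree.vertical (g : AffTree q) +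
        AffTree.vertical (walk x n : AffTree q)))} ≤
      incrementLaw μ {x | ∃ v : TreeVertex q, L v.level ∧
        finalConfig x (AffTree.act v (g : AffTree q)) * AffTree.portrait (g : AffTree q) v ≠ 1} := by
  have hmeas1 : ∀ (N : ℕ) (g : DATree q), MeasurableSet {x : ℕ → DATree q | ∃ n < N,
      L (-(AffTree.vertical (g : AffTree q) + AffTree.vertical (walk x n : AffTree q)))} := by
    intro N g
    have : {x : ℕ → DATree q | ∃ n < N, L (-(AffTree.vertical (g : AffTree q) +
        AffTree.vertical (walk x n : AffTree q)))} = ⋃ n : ℕ, ⋃ _ : n < N,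
        (fun x => walk x n) ⁻¹' {h : DATree q | L (-(AffTree.vertical (g : AffTree q) +
          AffTree.vertical (h : AffTree q)))} := by
      ext x
      simp
    rw [this]
    exact .iUnion fun n => .iUnion fun _ => measurable_walk n .of_discrete
  have hmeas2 : ∀ g : DATree q, MeasurableSet {x : ℕ → DATree q | ∃ v : TreeVertex q, L v.level ∧
      finalConfig x (AffTree.act v (g : AffTree q)) *
        AffTree.portrait (g : AffTree q) v ≠ 1} := by
    intro g
    have : {x : ℕ → DATree q | ∃ v : TreeVertex q, L v.level ∧
        finalConfig x (AffTree.act v (g : AffTree q)) * AffTree.portrait (g : AffTree q) v ≠ 1} =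
        ⋃ v : TreeVertex q, ⋃ _ : L v.level,
        (fun x => finalConfig x (AffTree.act v (g : AffTree q))) ⁻¹'
          {σ | σ * AffTree.portrait (g : AffTree q) v ≠ 1} := by
      ext x
      simp
    rw [this]
    exact .iUnion fun v => .iUnion fun _ => measurable_finalConfig_apply _ .of_discrete
  induction N generalizing g with
  | zero => simp
  | succ N ih =>
    -- Induction on the horizon plays the role of a stopping time. The vertex `root.g⁻¹` has level
    -- `-Φ(g)`. If this level is in `L`, its final value is that of the root times a known
    -- permutation, and `hε` applies; otherwise the first increment is absorbed into `g`.
    by_cases hL : L (-AffTree.vertical (g : AffTree q))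
    · refine (mul_le_of_le_one_right' prob_le_one).trans
        ((hε (AffTree.portrait (g : AffTree q) (AffTree.act (root q) (g : AffTree q)⁻¹))⁻¹).trans
          (measure_mono fun x hx => ⟨AffTree.act (root q) (g : AffTree q)⁻¹, ?_, fun h => hx ?_⟩))
      · rw [AffTree.level_act, AffTree.vertical_inv]
        simpa [root, ray] using hL
      · rw [AffTree.act_act_inv] at h
        exact eq_inv_of_mul_eq_one_left h
    · rw [incrementLaw_apply μ (hmeas1 _ _), incrementLaw_apply μ (hmeas2 _),
        ← ENNReal.tsum_mul_left]
      refine ENNReal.tsum_le_tsum fun h => ?_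
      rw [mul_left_comm]
      gcongr
      calc _ ≤ ε * incrementLaw μ {x | ∃ n < N, L (-(AffTree.vertical ((g * h : DATree q) :
              AffTree q) + AffTree.vertical (walk x n : AffTree q)))} := by
            gcongr
            rintro x ⟨n, hn, hx⟩
            cases n with
            | zero =>
              refine absurd ?_ hL
              change L (-(_ + AffTree.vertical (1 : AffTree q))) at hx
              rwa [AffTree.vertical_one, add_zero] at hx
            | succ n =>
              refine ⟨n, by omega, ?_⟩
              rw [walk_cons, vertical_mul, ← add_assoc] at hx
              rwa [vertical_mul]
        _ ≤ _ := ih (g * h)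
        _ ≤ _ := by
          refine measure_mono_ae ?_
          filter_upwards [ae_stabilizes hq hfin hμ] with x hs
          rintro ⟨v, hv, hx⟩
          refine ⟨v, hv, fun h' => hx ?_⟩
          rw [finalConfig_cons h hs, mul_assoc] at h'
          change finalConfig x (AffTree.act v ((g : AffTree q) * (h : AffTree q))) *
            AffTree.portrait ((g : AffTree q) * (h : AffTree q)) v = 1
          rwa [AffTree.portrait_mul, AffTree.act_mul]

/-- The case `g = 1` of `mul_measure_hit_le`, with the horizon `N` sent to infinity. The bound `ε`
does not depend on `L`. -/
theorem le_measure_exists_level (hq : 2 ≤ q) {μ : PMF (DATree q)} (hfin : μ.support.Finite)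
    (hμ : Aperiodic μ) {ε : ℝ≥0∞}
    (hε : ∀ σ, ε ≤ incrementLaw μ {x | finalConfig x (root q) ≠ σ}) (L : ℤ → Prop)
    (hL : ∀ᵐ x ∂incrementLaw μ, ∃ n, L (-AffTree.vertical (walk x n : AffTree q))) :
    ε ≤ incrementLaw μ {x | ∃ v : TreeVertex q, L v.level ∧ finalConfig x v ≠ 1} := by
  have hone : incrementLaw μ (⋃ N : ℕ, {x | ∃ n < N,
      L (-(AffTree.vertical ((1 : DATree q) : AffTree q) +
        AffTree.vertical (walk x n : AffTree q)))}) = 1 := by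
    rw [measure_congr (t := univ), measure_univ]
    refine eventuallyEq_univ.2 ?_
    filter_upwards [hL] with x ⟨n, hn⟩
    refine mem_iUnion.2 ⟨n + 1, n, by omega, ?_⟩
    change L (-(AffTree.vertical (1 : AffTree q) + _))
    rwa [AffTree.vertical_one, zero_add]
  have hmono : Monotone fun N : ℕ => {x : ℕ → DATree q | ∃ n < N,
      L (-(AffTree.vertical ((1 : DATree q) : AffTree q) +
        AffTree.vertical (walk x n : AffTree q)))} := by
    rintro M N hMN x ⟨n, hn, h⟩
    exact ⟨n, hn.trans_le hMN, h⟩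
  rw [hmono.measure_iUnion] at hone
  rw [← mul_one ε, ← hone, ENNReal.mul_iSup]
  refine iSup_le fun N => (mul_measure_hit_le hq hfin hμ hε L N 1).trans (measure_mono ?_)
  rintro x ⟨v, hv, hx⟩
  refine ⟨v, hv, fun h => hx ?_⟩
  change finalConfig x v * AffTree.portrait (1 : AffTree q) v = 1
  rw [AffTree.portrait_one, mul_one, h]

/-! ### Configurations nontrivial at unbounded levels; the zero-one law -/

/-- The configurations that are nontrivial at levels `m` with `s * m` arbitrarily large. -/
def unboundedConfigs (q : ℕ) [NeZero q] (s : ℤ) : Set (TreeConfig q) :=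
  {γ | ∀ k : ℕ, ∃ v : TreeVertex q, (k : ℤ) ≤ s * v.level ∧ γ v ≠ 1}

theorem measurableSet_unboundedConfigs (s : ℤ) : MeasurableSet (unboundedConfigs q s) := by
  have : unboundedConfigs q s = ⋂ k : ℕ, ⋃ v : TreeVertex q, ⋃ _ : (k : ℤ) ≤ s * v.level,
      (fun γ : TreeConfig q => γ v) ⁻¹' {1}ᶜ := by
    ext γ
    simp [unboundedConfigs]
  rw [this]
  exact .iInter fun k => .iUnion fun v => .iUnion fun _ => measurable_pi_apply v .of_discrete

theorem exists_portrait_eq_one (g : DATree q) (s : ℤ) :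
    ∃ C : ℕ, ∀ v : TreeVertex q, (C : ℤ) ≤ s * v.level →
      AffTree.portrait (g : AffTree q) v = 1 := by
  have hf : {v | AffTree.portrait (g : AffTree q) v ≠ 1}.Finite := g.2
  obtain ⟨C, hC⟩ := (hf.image fun v => s * v.level).bddAbove
  refine ⟨(C + 1).toNat, fun v hv => ?_⟩
  by_contra h
  have := hC ⟨v, h, rfl⟩
  simp only at this
  omega

/-- A new first increment translates all levels by the same amount and multiplies the configuration
by a portrait that is trivial off a finite set; neither affects unboundedness. -/
theorem finalConfig_cons_mem_iff (g : DATree q) {x : ℕ → DATree q} (h : Stabilizes x) (s : ℤ) :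
    finalConfig (cons g x) ∈ unboundedConfigs q s ↔ finalConfig x ∈ unboundedConfigs q s := by
  obtain ⟨C, hC⟩ := exists_portrait_eq_one g s
  constructor
  · intro H k
    obtain ⟨v, hv, hne⟩ := H (C + k + (s * AffTree.vertical (g : AffTree q)).natAbs)
    push_cast at hv
    have habs := neg_abs_le (s * AffTree.vertical (g : AffTree q))
    have habs' := abs_nonneg (s * AffTree.vertical (g : AffTree q))
    refine ⟨AffTree.act v (g : AffTree q), ?_, fun h' => hne ?_⟩
    · rw [AffTree.level_act, mul_add]
      omega
    · rw [finalConfig_cons g h, h', hC v (by omega), mul_one]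
  · intro H k
    obtain ⟨v, hv, hne⟩ := H (C + k + (s * AffTree.vertical (g : AffTree q)).natAbs)
    push_cast at hv
    have habs := le_abs_self (s * AffTree.vertical (g : AffTree q))
    have habs' := abs_nonneg (s * AffTree.vertical (g : AffTree q))
    have hl : s * (AffTree.act v (g : AffTree q)⁻¹).level =
        s * v.level - s * AffTree.vertical (g : AffTree q) := by
      rw [AffTree.level_act, AffTree.vertical_inv]
      ring
    refine ⟨AffTree.act v (g : AffTree q)⁻¹, by omega, fun h' => hne ?_⟩
    rwa [finalConfig_cons g h, AffTree.act_act_inv, hC _ (by omega), mul_one] at h'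

/-- The zero-one law for events that do not depend on the first increment. -/
theorem measure_zero_or_one_of_cons (μ : PMF (DATree q)) {A : Set (ℕ → DATree q)}
    (hA : MeasurableSet A) (hcons : ∀ g x, cons g x ∈ A ↔ x ∈ A) :
    incrementLaw μ A = 0 ∨ incrementLaw μ A = 1 := by
  let m : ℕ → MeasurableSpace (ℕ → DATree q) := fun n =>
    MeasurableSpace.comap (fun x => x n) inferInstance
  -- Invariance under prepending makes `A` depend only on the increments from time `n` on, for every
  -- `n`; it is a tail event, and Kolmogorov's law applies.
  have hshift : ∀ n, (fun (x : ℕ → DATree q) i => x (i + n)) ⁻¹' A = A := by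
    intro n
    induction n with
    | zero => rfl
    | succ n ih =>
      ext x
      have e : (fun i => x (i + n)) = cons (x n) fun i => x (i + (n + 1)) := by
        funext i
        cases i with
        | zero => simp [cons]
        | succ i => simp [cons, add_comm, add_left_comm]
      have h : (fun i => x (i + n)) ∈ A ↔ x ∈ A := Set.ext_iff.1 ih x
      rw [e, hcons] at h
      exact h
  refine ProbabilityTheory.measure_zero_or_one_of_measurableSet_limsup_atTop (s := m) ?_ ?_ ?_
  · exact fun n => (measurable_pi_apply n).comap_le
  · exact ProbabilityTheory.iIndepFun_infinitePi (P := fun _ : ℕ => μ.toMeasure)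
      (X := fun _ g => g) fun _ => measurable_id
  · rw [limsup_eq_iInf_iSup_of_nat, MeasurableSpace.measurableSet_iInf]
    intro n
    have hm : Measurable[⨆ i, ⨆ (_ : i ≥ n), m i] fun (x : ℕ → DATree q) i => x (i + n) := by
      refine (@measurable_pi_iff _ _ _ (⨆ i, ⨆ (_ : i ≥ n), m i) _ _).2 fun i => ?_
      refine Measurable.mono (comap_measurable fun x : ℕ → DATree q => x (i + n)) ?_ le_rfl
      exact le_iSup₂_of_le (i + n) (by omega) le_rfl
    rw [← hshift n]
    exact hm hA

/-- If the walk moves vertices at levels `m`, with `s * m` arbitrarily large, to the root, then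
the final configuration is nontrivial at such levels. -/
theorem ae_finalConfig_mem_unboundedConfigs (hq : 2 ≤ q) {μ : PMF (DATree q)}
    (hfin : μ.support.Finite) (hμ : Aperiodic μ) (s : ℤ)
    (hs : ∀ᵐ x ∂incrementLaw μ, ∀ k : ℕ, ∃ n,
      (k : ℤ) ≤ s * -AffTree.vertical (walk x n : AffTree q)) :
    ∀ᵐ x ∂incrementLaw μ, finalConfig x ∈ unboundedConfigs q s := by
  obtain ⟨ε, hε0, hε⟩ := exists_le_measure_finalConfig_root_ne hq hfin hμ
  -- The zero-one law asks for invariance at every point, while the final configuration transforms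
  -- well only where the portraits stabilize; hence the intersection.
  let U : Set (ℕ → DATree q) := {x | Stabilizes x} ∩ finalConfig ⁻¹' unboundedConfigs q s
  have hU : MeasurableSet U :=
    measurableSet_stabilizes.inter (measurable_finalConfig (measurableSet_unboundedConfigs s))
  have hε' : ε ≤ incrementLaw μ U := by
    have hU' : incrementLaw μ U = incrementLaw μ (⋂ k : ℕ, {x | ∃ v : TreeVertex q,
        (k : ℤ) ≤ s * v.level ∧ finalConfig x v ≠ 1}) := by
      refine measure_congr ?_
      filter_upwards [ae_stabilizes hq hfin hμ] with x hx
      refine propext ⟨fun h => mem_iInter.2 h.2, fun h => ⟨hx, mem_iInter.1 h⟩⟩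
    -- The events decrease with `k` and all have probability at least the same `ε`, so their
    -- intersection does too.
    rw [hU', Antitone.measure_iInter]
    · refine le_iInf fun k => le_measure_exists_level hq hfin hμ hε (fun m => (k : ℤ) ≤ s * m) ?_
      filter_upwards [hs] with x hx using hx k
    · rintro j k hjk x ⟨v, hv, hx⟩
      exact ⟨v, le_trans (by exact_mod_cast hjk) hv, hx⟩
    · intro k
      have : {x : ℕ → DATree q | ∃ v : TreeVertex q, (k : ℤ) ≤ s * v.level ∧
          finalConfig x v ≠ 1} = ⋃ v : TreeVertex q, ⋃ _ : (k : ℤ) ≤ s * v.level,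
          (fun x => finalConfig x v) ⁻¹' {1}ᶜ := by
        ext x
        simp
      rw [this]
      exact (MeasurableSet.iUnion fun v => .iUnion fun _ =>
        measurable_finalConfig_apply v .of_discrete).nullMeasurableSet
    · exact ⟨0, measure_ne_top _ _⟩
  have h01 : incrementLaw μ U = 1 := by
    refine (measure_zero_or_one_of_cons μ hU fun g x => ?_).resolve_left fun h0 => ?_
    · change (Stabilizes (cons g x) ∧ _) ↔ (Stabilizes x ∧ _)
      rw [stabilizes_cons_iff]
      exact and_congr_right fun h => finalConfig_cons_mem_iff g h s
    · rw [h0] at hε'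
      exact hε0 (le_antisymm hε' zero_le)
  filter_upwards [(mem_ae_iff_prob_eq_one hU).2 h01] with x hx using hx.2

/-- If the walk does not move vertices at levels `m`, with `s * m` large, close to the root, then
the final configuration is trivial at such levels. -/
theorem ae_finalConfig_notMem_unboundedConfigs {μ : PMF (DATree q)}
    (hfin : μ.support.Finite) (s : ℤ)
    (hs : ∀ᵐ x ∂incrementLaw μ, ∃ C : ℤ, ∀ n,
      C ≤ s * AffTree.vertical (walk x n : AffTree q)) :
    ∀ᵐ x ∂incrementLaw μ, finalConfig x ∉ unboundedConfigs q s := by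
  obtain ⟨K, hK⟩ := ((portraitSupport_finite hfin).image fun v => s * v.level).bddAbove
  filter_upwards [hs, ae_mem_support μ] with x ⟨C, hC⟩ hx hmem
  -- At such a level, `s` times the level of `v.w_n` is at least `(K - C + 1) + C > K` for all `n`,
  -- so the trajectory never meets `portraitSupport μ`.
  obtain ⟨v, hv, hne⟩ := hmem (K - C + 1).toNat
  have hone : ∀ n, AffTree.portrait (walk x n : AffTree q) v = 1 := by
    intro n
    induction n with
    | zero => exact AffTree.portrait_one v
    | succ n ih =>
      rw [portrait_walk_succ_eq (hx n), ih]
      intro h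
      have h1 := hK ⟨_, h, rfl⟩
      simp only [AffTree.level_act, mul_add] at h1
      have := hC n
      omega
  have : StabilizesTo x v 1 := Eventually.of_forall hone
  exact hne this.finalConfig_eq

/-! ### Asymptotics of the vertical displacement -/

open ProbabilityTheory

theorem vertical_walk (x : ℕ → DATree q) (n : ℕ) : AffTree.vertical (walk x n : AffTree q) =
    ∑ i ∈ Finset.range n, AffTree.vertical (x i : AffTree q) := by
  induction n with
  | zero => exact AffTree.vertical_one
  | succ n ih => rw [walk, vertical_mul, ih, Finset.sum_range_succ]

theorem exists_abs_le {μ : PMF (DATree q)} (hfin : μ.support.Finite) (f : DATree q → ℝ) :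
    ∃ R : NNReal, ∀ g ∈ μ.support, |f g| ≤ R := by
  obtain ⟨R, hR⟩ := (hfin.image fun g => |f g|).bddAbove
  exact ⟨R.toNNReal, fun g hg => (hR ⟨g, hg, rfl⟩).trans (Real.le_coe_toNNReal R)⟩

theorem integrable_toMeasure {μ : PMF (DATree q)} (hfin : μ.support.Finite) (f : DATree q → ℝ) :
    Integrable f μ.toMeasure := by
  obtain ⟨R, hR⟩ := exists_abs_le hfin f
  refine Integrable.of_bound Measurable.of_discrete.aestronglyMeasurable R ?_
  filter_upwards [ae_toMeasure_mem_support μ] with g hg using hR g hg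

theorem integrable_increment {μ : PMF (DATree q)} (hfin : μ.support.Finite) (f : DATree q → ℝ)
    (n : ℕ) : Integrable (fun x => f (x n)) (incrementLaw μ) := by
  have h := integrable_toMeasure hfin f
  rw [← map_eval_incrementLaw μ n] at h
  exact h.comp_measurable (measurable_pi_apply n)

theorem integral_increment (μ : PMF (DATree q)) (f : DATree q → ℝ) (n : ℕ) :
    ∫ x, f (x n) ∂incrementLaw μ = ∫ g, f g ∂μ.toMeasure := by
  rw [← map_eval_incrementLaw μ n, integral_map (measurable_pi_apply n).aemeasurable
    Measurable.of_discrete.aestronglyMeasurable]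

theorem iIndepFun_increment (μ : PMF (DATree q)) (f : DATree q → ℝ) :
    iIndepFun (fun n x => f (x n)) (incrementLaw μ) :=
  iIndepFun_infinitePi (P := fun _ : ℕ => μ.toMeasure) (X := fun _ => f)
    fun _ => Measurable.of_discrete

theorem measurable_increment (f : DATree q → ℝ) (n : ℕ) :
    Measurable fun x : ℕ → DATree q => f (x n) :=
  Measurable.of_discrete.comp (measurable_pi_apply n)

theorem ae_tendsto_average {μ : PMF (DATree q)} (hfin : μ.support.Finite) (f : DATree q → ℝ) :
    ∀ᵐ x ∂incrementLaw μ, Tendsto (fun n : ℕ => (∑ i ∈ Finset.range n, f (x i)) / n) atTop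
      (nhds (∫ g, f g ∂μ.toMeasure)) := by
  have h := strong_law_ae_real (fun n (x : ℕ → DATree q) => f (x n)) (integrable_increment hfin f 0)
    (fun i j hij => (iIndepFun_increment μ f).indepFun hij) fun i =>
      ⟨(measurable_increment f i).aemeasurable, (measurable_increment f 0).aemeasurable, by
        have e : ∀ i, (incrementLaw μ).map (fun x => f (x i)) = μ.toMeasure.map f := fun i => by
          rw [← map_eval_incrementLaw μ i]
          exact (Measure.map_map Measurable.of_discrete (measurable_pi_apply i)).symm
        rw [e, e]⟩
  rwa [integral_increment] at h

/-- Inversion changes the sign of `Φ`, so a hypothesis on the reversed measure is the opposite one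
on the increments of the walk. -/
theorem drift_reverse {μ : PMF (DATree q)} (hfin : μ.support.Finite) :
    drift (reverse μ) = -∫ g, (AffTree.vertical (g : AffTree q) : ℝ) ∂μ.toMeasure := by
  rw [PMF.integral_eq_tsum _ _ (integrable_toMeasure hfin _), drift, ← tsum_neg,
    ← (Equiv.inv (DATree q)).tsum_eq]
  refine tsum_congr fun g => ?_
  have h1 : reverse μ g⁻¹ = μ g := by
    rw [reverse, PMF.map_apply, tsum_eq_single g fun h hh => if_neg fun e => hh (inv_injective e).symm,
      if_pos rfl]
  have h2 : AffTree.vertical ((g⁻¹ : DATree q) : AffTree q) = -AffTree.vertical (g : AffTree q) :=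
    AffTree.vertical_inv _
  rw [Equiv.inv_apply, h1, h2, smul_eq_mul]
  push_cast
  ring

/-- For a positive (negative) drift, the walk tends to the distinguished end or away from it. -/
theorem ae_tendsto_mul_vertical {μ : PMF (DATree q)} (hfin : μ.support.Finite) (s : ℤ)
    (hs : 0 < s * ∫ g, (AffTree.vertical (g : AffTree q) : ℝ) ∂μ.toMeasure) :
    ∀ᵐ x ∂incrementLaw μ,
      Tendsto (fun n => s * AffTree.vertical (walk x n : AffTree q)) atTop atTop := by
  filter_upwards [ae_tendsto_average hfin fun g => (AffTree.vertical (g : AffTree q) : ℝ)]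
    with x hx
  rw [← tendsto_intCast_atTop_iff (R := ℝ)]
  refine (((hx.const_mul (s : ℝ)).pos_mul_atTop hs tendsto_natCast_atTop_atTop)).congr' ?_
  filter_upwards [eventually_ne_atTop 0] with n hn
  rw [vertical_walk]
  push_cast
  field_simp

/-- Otherwise `Φ` would vanish on the support of every convolution power, yet some power charges
`shift q`. -/
theorem exists_mem_support_vertical_ne {μ : PMF (DATree q)} (hμ : Aperiodic μ) :
    ∃ g ∈ μ.support, AffTree.vertical (g : AffTree q) ≠ 0 := by
  by_contra! h
  have key : ∀ l, ∀ g ∈ (convPow μ l).support, AffTree.vertical (g : AffTree q) = 0 := by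
    intro l
    induction l with
    | zero =>
      intro g hg
      rw [convPow, PMF.mem_support_pure_iff] at hg
      rw [hg]
      exact AffTree.vertical_one
    | succ l ih =>
      intro g hg
      rw [convPow, PMF.mem_support_bind_iff] at hg
      obtain ⟨a, ha, hg⟩ := hg
      rw [PMF.mem_support_map_iff] at hg
      obtain ⟨b, hb, rfl⟩ := hg
      rw [vertical_mul, ih a ha, h b hb, add_zero]
  obtain ⟨l, -, hl, -⟩ := hμ (shift q) 1
  have := key l _ hl
  rw [vertical_shift] at this
  exact one_ne_zero this

/-- The averages of `|Φ(x i)|` would tend to `0`, but by the law of large numbers they tend to the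
mean of `|Φ|`, which is positive. -/
theorem ae_not_eventually_vertical_eq_zero {μ : PMF (DATree q)} (hfin : μ.support.Finite)
    (hμ : Aperiodic μ) :
    ∀ᵐ x ∂incrementLaw μ, ¬ ∀ᶠ n in atTop, AffTree.vertical (x n : AffTree q) = 0 := by
  filter_upwards [ae_tendsto_average hfin fun g => |(AffTree.vertical (g : AffTree q) : ℝ)|]
    with x hx h
  obtain ⟨N, hN⟩ := eventually_atTop.1 h
  have h0 : Tendsto (fun n : ℕ => (∑ i ∈ Finset.range n,
      |(AffTree.vertical (x i : AffTree q) : ℝ)|) / n) atTop (nhds 0) := by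
    refine (tendsto_const_div_atTop_nhds_zero_nat (∑ i ∈ Finset.range N,
      |(AffTree.vertical (x i : AffTree q) : ℝ)|)).congr' ?_
    filter_upwards [eventually_ge_atTop N] with n hn
    congr 1
    refine Finset.sum_subset (Finset.range_subset_range.2 hn) fun i _ hi => ?_
    rw [hN i (by simpa using hi)]
    simp
  have hzero := tendsto_nhds_unique hx h0
  rw [integral_eq_zero_iff_of_nonneg (fun g => abs_nonneg _) (integrable_toMeasure hfin _)] at hzero
  obtain ⟨g, hg, hne⟩ := exists_mem_support_vertical_ne hμ
  have hg' : μ.toMeasure {g} ≠ 0 := by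
    rwa [PMF.toMeasure_apply_singleton _ _ (measurableSet_singleton g)]
  have hnull : μ.toMeasure {g | ¬ |(AffTree.vertical (g : AffTree q) : ℝ)| = 0} = 0 :=
    ae_iff.1 hzero
  have hmem : g ∈ {g : DATree q | ¬ |(AffTree.vertical (g : AffTree q) : ℝ)| = 0} := by
    simpa using hne
  exact hg' (measure_mono_null (singleton_subset_iff.2 hmem) hnull)

/-- The partial sums of centred increments converge as soon as they are bounded on one side. -/
theorem ae_exists_tendsto_sum {μ : PMF (DATree q)} (hfin : μ.support.Finite) {f : DATree q → ℝ}
    (h0 : ∫ g, f g ∂μ.toMeasure = 0) :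
    ∀ᵐ x ∂incrementLaw μ,
      (BddAbove (range fun n => ∑ i ∈ Finset.range (n + 1), f (x i)) ∨
        BddBelow (range fun n => ∑ i ∈ Finset.range (n + 1), f (x i))) →
      ∃ c, Tendsto (fun n => ∑ i ∈ Finset.range (n + 1), f (x i)) atTop (nhds c) := by
  let X : ℕ → (ℕ → DATree q) → ℝ := fun n x => f (x n)
  have hX : ∀ n, StronglyMeasurable (X n) := fun n => (measurable_increment f n).stronglyMeasurable
  let S : ℕ → (ℕ → DATree q) → ℝ := fun n => ∑ i ∈ Finset.range (n + 1), X i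
  have hint : ∀ n, Integrable (S n) (incrementLaw μ) := fun n =>
    integrable_finsetSum' _ fun i _ => integrable_increment hfin f i
  have hsub : ∀ n, S (n + 1) - S n = X (n + 1) := fun n => by
    simp only [S]
    rw [Finset.sum_range_succ _ (n + 1), add_sub_cancel_left]
  have hmart : Martingale S (Filtration.natural X hX) (incrementLaw μ) := by
    refine martingale_of_condExp_sub_eq_zero_nat (fun n => ?_) hint fun n => ?_
    · refine Finset.stronglyMeasurable_sum _ fun i hi => ?_
      exact (Filtration.stronglyAdapted_natural hX i).mono
        ((Filtration.natural X hX).mono (by simpa [Nat.lt_succ_iff] using hi))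
    · rw [hsub]
      refine ((iIndepFun_increment μ f).condExp_natural_ae_eq_of_lt hX n.lt_succ_self).trans ?_
      rw [integral_increment, h0]
      rfl
  obtain ⟨R, hR⟩ := exists_abs_le hfin f
  have hbdd : ∀ᵐ x ∂incrementLaw μ, ∀ i, |S (i + 1) x - S i x| ≤ R := by
    filter_upwards [ae_mem_support μ] with x hx i
    rw [← Pi.sub_apply, hsub]
    exact hR _ (hx (i + 1))
  have hS : ∀ x n, S n x = ∑ i ∈ Finset.range (n + 1), f (x i) := fun x n => by
    simp only [S, Finset.sum_apply, X]
  -- A martingale with bounded increments is almost surely bounded above exactly when it is bounded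
  -- below, and exactly when it converges.
  filter_upwards [hmart.bddAbove_range_iff_bddBelow_range hbdd,
    hmart.submartingale.bddAbove_iff_exists_tendsto hbdd] with x h1 h2
  simp only [← hS]
  rw [← h1, or_self, ← h2]
  exact id

/-- For zero drift, the walk is unbounded in both vertical directions. -/
theorem ae_not_bddAbove_vertical {μ : PMF (DATree q)} (hfin : μ.support.Finite)
    (hμ : Aperiodic μ)
    (h0 : ∫ g, (AffTree.vertical (g : AffTree q) : ℝ) ∂μ.toMeasure = 0) :
    ∀ᵐ x ∂incrementLaw μ,
      ¬ BddAbove (range fun n => (AffTree.vertical (walk x (n + 1) : AffTree q) : ℝ)) ∧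
      ¬ BddBelow (range fun n => (AffTree.vertical (walk x (n + 1) : AffTree q) : ℝ)) := by
  filter_upwards [ae_exists_tendsto_sum hfin h0, ae_not_eventually_vertical_eq_zero hfin hμ]
    with x h1 h2
  have hS : ∀ n, (AffTree.vertical (walk x (n + 1) : AffTree q) : ℝ) =
      ∑ i ∈ Finset.range (n + 1), (AffTree.vertical (x i : AffTree q) : ℝ) := fun n => by
    rw [vertical_walk, Int.cast_sum]
  simp only [hS]
  rw [← not_or]
  refine fun h => h2 ?_
  -- A convergent sequence of integers has increments that are eventually less than `1` in absolute
  -- value, hence zero, against `h2`.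
  obtain ⟨c, hc⟩ := h1 h
  have hlim := ((hc.comp (tendsto_add_atTop_nat 1)).sub hc).abs
  rw [sub_self, abs_zero] at hlim
  rw [← map_add_atTop_eq_nat 1, eventually_map]
  filter_upwards [hlim.eventually_lt_const one_pos] with n hn
  rw [Function.comp_apply, Finset.sum_range_succ _ (n + 1), add_sub_cancel_left] at hn
  have hn' : |AffTree.vertical (x (n + 1) : AffTree q)| < 1 := by exact_mod_cast hn
  exact Int.abs_lt_one_iff.1 hn'

theorem ae_exists_le_mul_vertical {μ : PMF (DATree q)} (hfin : μ.support.Finite)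
    (hμ : Aperiodic μ)
    (h0 : ∫ g, (AffTree.vertical (g : AffTree q) : ℝ) ∂μ.toMeasure = 0) {s : ℤ}
    (hs : s = 1 ∨ s = -1) :
    ∀ᵐ x ∂incrementLaw μ, ∀ k : ℕ, ∃ n,
      (k : ℤ) ≤ s * -AffTree.vertical (walk x n : AffTree q) := by
  filter_upwards [ae_not_bddAbove_vertical hfin hμ h0] with x hx k
  by_contra! h
  rcases hs with rfl | rfl
  · refine hx.2 ⟨((-k : ℤ) : ℝ), ?_⟩
    rintro _ ⟨n, rfl⟩
    have := h (n + 1)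
    exact Int.cast_le.2 (by omega : -(k : ℤ) ≤ AffTree.vertical (walk x (n + 1) : AffTree q))
  · refine hx.1 ⟨((k : ℤ) : ℝ), ?_⟩
    rintro _ ⟨n, rfl⟩
    have := h (n + 1)
    exact Int.cast_le.2 (by omega : AffTree.vertical (walk x (n + 1) : AffTree q) ≤ (k : ℤ))

/-! ### Separation of the harmonic measures by the sign of the drift -/

theorem ae_notMem_unboundedConfigs_of_drift {μ : PMF (DATree q)} (hfin : μ.support.Finite) (s : ℤ)
    (hs : 0 < s * ∫ g, (AffTree.vertical (g : AffTree q) : ℝ) ∂μ.toMeasure) :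
    ∀ᵐ x ∂incrementLaw μ, finalConfig x ∉ unboundedConfigs q s := by
  refine ae_finalConfig_notMem_unboundedConfigs hfin s ?_
  filter_upwards [ae_tendsto_mul_vertical hfin s hs] with x hx
  obtain ⟨C, hC⟩ := bddBelow_range_of_tendsto_atTop_atTop hx
  exact ⟨C, fun n => hC ⟨n, rfl⟩⟩

theorem ae_mem_unboundedConfigs_of_drift (hq : 2 ≤ q) {μ : PMF (DATree q)}
    (hfin : μ.support.Finite) (hμ : Aperiodic μ) (s : ℤ)
    (hs : 0 < (-s : ℤ) * ∫ g, (AffTree.vertical (g : AffTree q) : ℝ) ∂μ.toMeasure) :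
    ∀ᵐ x ∂incrementLaw μ, finalConfig x ∈ unboundedConfigs q s := by
  refine ae_finalConfig_mem_unboundedConfigs hq hfin hμ s ?_
  filter_upwards [ae_tendsto_mul_vertical hfin (-s) hs] with x hx k
  obtain ⟨n, hn⟩ := (hx.eventually_ge_atTop (k : ℤ)).exists
  exact ⟨n, by rwa [mul_neg, ← neg_mul]⟩

theorem harmonicMeasure_eq_one {μ : PMF (DATree q)} {A : Set (TreeConfig q)}
    (hA : MeasurableSet A) (h : ∀ᵐ x ∂incrementLaw μ, finalConfig x ∈ A) :
    harmonicMeasure μ A = 1 := by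
  rw [harmonicMeasure, Measure.map_apply measurable_finalConfig hA]
  exact (mem_ae_iff_prob_eq_one (measurable_finalConfig hA)).1 h

end DATree

theorem MeasureTheory.Measure.MutuallySingular.of_measure_eq_one {α : Type*} [MeasurableSpace α]
    {μ ν : Measure α} [IsProbabilityMeasure μ] [IsProbabilityMeasure ν] {A B : Set α}
    (hA : MeasurableSet A) (hB : MeasurableSet B) (hAB : Disjoint A B) (hμ : μ A = 1)
    (hν : ν B = 1) : μ.MutuallySingular ν := by
  refine ⟨Aᶜ, hA.compl, (prob_compl_eq_zero_iff hA).2 hμ, ?_⟩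
  rw [compl_compl]
  exact measure_mono_null hAB.subset_compl_right ((prob_compl_eq_zero_iff hB).2 hν)

theorem proposition4p9 (q : ℕ) [NeZero q] (hq : 2 ≤ q)
    (μneg μzero μpos : PMF (DATree q))
    (hfin_neg : μneg.support.Finite) (hfin_zero : μzero.support.Finite)
    (hfin_pos : μpos.support.Finite)
    (hap_neg : DATree.Aperiodic μneg) (hap_zero : DATree.Aperiodic μzero)
    (hap_pos : DATree.Aperiodic μpos)
    (hneg : DATree.drift (DATree.reverse μneg) < 0)
    (hzero : DATree.drift (DATree.reverse μzero) = 0)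
    (hpos : 0 < DATree.drift (DATree.reverse μpos)) :
    -- the final configurations exist almost surely
    (∀ μ ∈ ({μneg, μzero, μpos} : Set (PMF (DATree q))),
      ∀ᵐ x ∂(DATree.incrementLaw μ), ∀ v, ∃ σ, DATree.StabilizesTo x v σ) ∧
    -- the harmonic measures are carried by pairwise disjoint Borel sets
    (∃ Aneg Azero Apos : Set (TreeConfig q),
      MeasurableSet Aneg ∧ MeasurableSet Azero ∧ MeasurableSet Apos ∧
      Disjoint Aneg Azero ∧ Disjoint Aneg Apos ∧ Disjoint Azero Apos ∧
      DATree.harmonicMeasure μneg Aneg = 1 ∧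
      DATree.harmonicMeasure μzero Azero = 1 ∧
      DATree.harmonicMeasure μpos Apos = 1) ∧
    -- the harmonic measures are mutually singular
    (DATree.harmonicMeasure μneg).MutuallySingular (DATree.harmonicMeasure μzero) ∧
    (DATree.harmonicMeasure μneg).MutuallySingular (DATree.harmonicMeasure μpos) ∧
    (DATree.harmonicMeasure μzero).MutuallySingular (DATree.harmonicMeasure μpos) := by
  let U : ℤ → Set (TreeConfig q) := DATree.unboundedConfigs q
  have hU : ∀ s, MeasurableSet (U s) := DATree.measurableSet_unboundedConfigs
  rw [DATree.drift_reverse hfin_neg, neg_lt_zero] at hneg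
  rw [DATree.drift_reverse hfin_zero, neg_eq_zero] at hzero
  rw [DATree.drift_reverse hfin_pos, neg_pos] at hpos
  have hneg1 := DATree.ae_notMem_unboundedConfigs_of_drift hfin_neg 1 (by simpa using hneg)
  have hpos1 := DATree.ae_mem_unboundedConfigs_of_drift hq hfin_pos hap_pos 1 (by simpa using hpos)
  have hpos2 := DATree.ae_notMem_unboundedConfigs_of_drift hfin_pos (-1) (by simpa using hpos)
  have hzero1 := DATree.ae_finalConfig_mem_unboundedConfigs hq hfin_zero hap_zero 1
    (DATree.ae_exists_le_mul_vertical hfin_zero hap_zero hzero (Or.inl rfl))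
  have hzero2 := DATree.ae_finalConfig_mem_unboundedConfigs hq hfin_zero hap_zero (-1)
    (DATree.ae_exists_le_mul_vertical hfin_zero hap_zero hzero (Or.inr rfl))
  -- `U 1` asks for nontrivial values at arbitrarily high levels and `U (-1)` at arbitrarily low
  -- ones. For `μneg` the walk has `Φ(w_n) → +∞`, which excludes `U 1`; for `μpos` it has `Φ(w_n) →
  -- -∞`, which gives `U 1` and excludes `U (-1)`; for `μzero` both hold.
  have mneg : MeasurableSet (U 1)ᶜ := (hU 1).compl
  have mzero : MeasurableSet (U 1 ∩ U (-1)) := (hU 1).inter (hU (-1))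
  have mpos : MeasurableSet (U 1 \ U (-1)) := (hU 1).diff (hU (-1))
  have dnz : Disjoint (U 1)ᶜ (U 1 ∩ U (-1)) := disjoint_left.2 fun _ h h' => h h'.1
  have dnp : Disjoint (U 1)ᶜ (U 1 \ U (-1)) := disjoint_left.2 fun _ h h' => h h'.1
  have dzp : Disjoint (U 1 ∩ U (-1)) (U 1 \ U (-1)) := disjoint_left.2 fun _ h h' => h'.2 h.2
  have eneg : DATree.harmonicMeasure μneg (U 1)ᶜ = 1 := DATree.harmonicMeasure_eq_one mneg hneg1
  have ezero : DATree.harmonicMeasure μzero (U 1 ∩ U (-1)) = 1 :=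
    DATree.harmonicMeasure_eq_one mzero (hzero1.and hzero2)
  have epos : DATree.harmonicMeasure μpos (U 1 \ U (-1)) = 1 :=
    DATree.harmonicMeasure_eq_one mpos (hpos1.and hpos2)
  refine ⟨?_, ⟨_, _, _, mneg, mzero, mpos, dnz, dnp, dzp, eneg, ezero, epos⟩,
    .of_measure_eq_one mneg mzero dnz eneg ezero, .of_measure_eq_one mneg mpos dnp eneg epos,
    .of_measure_eq_one mzero mpos dzp ezero epos⟩
  rintro μ (rfl | rfl | rfl)
  · exact DATree.ae_stabilizes hq hfin_neg hap_neg
  · exact DATree.ae_stabilizes hq hfin_zero hap_zero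
  · exact DATree.ae_stabilizes hq hfin_pos hap_pos
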